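/- **Setting.** Consider a Markov decision process with measurable state space $\mathcal S$ and action space $\mathcal A$ carrying $\sigma$-finite reference measures, finite horizon $T\in\mathbb N$, initial-state density $\rho_0$, transition density $p(s'|s,a)$, bounded reward $r$ and discount $\gamma\in[0,1]$. Let $\Theta\subseteq\mathbb R^{d}$ ($d=d_\Theta$) be open and convex and $\pi_\theta(a|s)$, $\theta\in\Theta$, a class of policy densities. For $\tau=(s_1,a_1,\dots,s_T,a_T)$ let $p_\theta(\tau)=\rho_0(s_1)\prod_{t=1}^{T}\pi_\theta(a_t|s_t)\prod_{t=1}^{T-1}p(s_{t+1}|s_t,a_t)$, $R(\tau)=\sum_{t=1}^T\gamma^{t-1}r(s_t,a_t)$, $J(\theta)=\mathbb E_{\tau\sim p_\theta}[R(\tau)]$, and let $g_\theta(\tau)$ be either the REINFORCE estimator $\sum_{t=1}^T\nabla\log\pi_\theta(a_t|s_t)\,R(\tau)$ or the GPOMDP estimator $\sum_{t=1}^T\big(\sum_{l=1}^t\nabla\log\pi_\theta(a_l|s_l)\big)\gamma^{t-1}r(s_t,a_t)$. **Assumptions.** (i) There are $L_1,L_2>0$ such that for all $\theta\in\Theta$,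 $s$, $a$: $\pi_\theta(a|s)>0$, $\log\pi_\theta(a|s)$ is twice differentiable in $\theta$, $\|\nabla\log\pi_\theta(a|s)\|_2\le L_1$ and $\|\nabla^2\log\pi_\theta(a|s)\|_2\le L_2$. (ii) There is $D\ge1$ with $\chi^2(p_{\theta_1}\|p_{\theta_2})=\int p_{\theta_1}^2/p_{\theta_2}-1\le D-1$ for all $\theta_1,\theta_2\in\Theta$. **Algorithm.** Let $\omega\ge1$, $\omega_k=\min\{\omega,k\}$, $k_0=k-\omega_k+1$, $N$ the batch size, $\zeta_i>0$ step sizes. For $i=1,2,\dots,k$, given $\theta_1,\tau_{1,\cdot},\dots,\theta_{i-1},\tau_{i-1,\cdot},\theta_i$, the trajectories $\tau_{i,1},\dots,\tau_{i,N}$ are i.i.d. with law $p_{\theta_i}$, and then $\theta_{i+1}=\theta_i+\zeta_i\,\widehat\nabla_{\omega_i}J(\theta_i)$, where $$\widehat\nabla_{\omega_k}J(\theta)=\sum_{i=k_0}^{k}\frac1N\sum_{j=1}^N\frac{\alpha_{i,k}\,g_\theta(\tau_{i,j})}{(1-\lambda_{i,k})\,p_{\theta_i}(\tau_{i,j})/p_\theta(\tau_{i,j})+\lambda_{i,k}}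 ;$$ the iterates $\theta_1,\dots,\theta_k$ lie in $\Theta$ almost surely. **Theorem.** Under (i) and (ii) there are $G,G_2>0$ with $\|g_\theta(\tau)\|_2\le G$ and $\|\nabla_\theta g_\theta(\tau)\|_2\le G_2$ for all $\theta\in\Theta$ and all $\tau$. Let $G,G_2>0$ be any such constants, $k\ge1$, $\delta\in(0,1)$, $\bar\zeta_k=\max_{k_0\le z\le k-1}\zeta_z$ ($0$ if $k_0=k$), and $$C_k=d\,\log\!\Big(6+(GTL_1+G_2)\Big(1+\sqrt{\tfrac34DN\omega_k}\Big)\frac{3\sqrt3\,\bar\zeta_k\,\omega_k^2N}{4\sqrt d}\Big)+\log\frac1\delta=\widetilde O\big(d+\log(1/\delta)\big).$$ Suppose $N\ge\frac{4C_k}{3D}$, $\alpha_{i,z}=1/\omega_z$ for all iterations $z\le k$, $\lambda_{i,k}=\sqrt{\frac{4C_k}{3DN\omega_k}}$ for $i\in\{k_0,\dots,k\}$, and at each earlier iteration $z<k$ the coefficients satisfy $\sqrt{\frac{4(d\log6+\log(1/\delta_z))}{3DN\omega_z}}\le\lambda_{i,z}\le1$ for some $\delta_z\in(0,1)$ (for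 instance $\lambda_{i,z}$ given by the same prescription at confidence level $\delta_z$, if at most $1$). Then with probability at least $1-\delta$ $$\big\|\widehat\nabla_{\omega_k}J(\theta_k)-\nabla J(\theta_k)\big\|_2\le16\,G\sqrt{\frac{D\,C_k}{N\omega_k}}=\widetilde O\Big(G\sqrt{\tfrac{D(d+\log(1/\delta))}{N\omega_k}}\Big).$$ -/

import Mathlib

open MeasureTheory

noncomputable section

namespace RPG

/-- A parameter vector in `ℝ^d` with the Euclidean norm. -/
abbrev Param (d : ℕ) : Type := EuclideanSpace ℝ (Fin d)

/-- A trajectory `(s₁, a₁, …, s_T, a_T)` of length `T`; step `t` of the text has index `t - 1`. -/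
abbrev Traj (S A : Type*) (T : ℕ) : Type _ := Fin T → S × A

/-- A Markov decision process with horizon `T`, whose initial-state distribution and transition
model have densities `init` and `trans s a` with respect to a reference measure `refS` on the
states; `refA` is the reference measure for the densities of the policies. -/
structure MDP (S A : Type*) [MeasurableSpace S] [MeasurableSpace A] (T : ℕ) where
  refS : Measure S
  refA : Measure A
  sigmaFinite_refS : SigmaFinite refS
  sigmaFinite_refA : SigmaFinite refA
  init : S → ℝ
  init_nonneg : ∀ s, 0 ≤ init s
  init_measurable : Measurable init
  lintegral_init : ∫⁻ s, ENNReal.ofReal (init s) ∂refS = 1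
  trans : S → A → S → ℝ
  trans_nonneg : ∀ s a s', 0 ≤ trans s a s'
  trans_measurable : Measurable fun x : S × A × S => trans x.1 x.2.1 x.2.2
  lintegral_trans : ∀ s a, ∫⁻ s', ENNReal.ofReal (trans s a s') ∂refS = 1
  reward : S → A → ℝ
  reward_measurable : Measurable fun x : S × A => reward x.1 x.2
  rewardBound : ℝ
  abs_reward_le : ∀ s a, |reward s a| ≤ rewardBound
  discount : ℝ
  discount_nonneg : 0 ≤ discount
  discount_le_one : discount ≤ 1

variable {S A : Type*} [MeasurableSpace S] [MeasurableSpace A] {T d : ℕ}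

/-- `pol θ s a` is the density `π_θ(a | s)` of a parametric stochastic policy, `θ ∈ Θ`. -/
structure IsPolicyClass (M : MDP S A T) (Θ : Set (Param d)) (pol : Param d → S → A → ℝ) :
    Prop where
  measurable : Measurable fun x : Param d × S × A => pol x.1 x.2.1 x.2.2
  nonneg : ∀ θ ∈ Θ, ∀ s a, 0 ≤ pol θ s a
  lintegral_eq_one : ∀ θ ∈ Θ, ∀ s, ∫⁻ a, ENNReal.ofReal (pol θ s a) ∂M.refA = 1

/-- Discounted return of a trajectory. -/
def ret (M : MDP S A T) (τ : Traj S A T) : ℝ :=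
  ∑ t : Fin T, M.discount ^ (t : ℕ) * M.reward (τ t).1 (τ t).2

/-- Density of the state visited at step `t`, given the preceding state and action. -/
def stateDensity (M : MDP S A T) (τ : Traj S A T) (t : Fin T) : ℝ :=
  if (t : ℕ) = 0 then M.init (τ t).1
  else
    let u : Fin T := ⟨(t : ℕ) - 1, lt_of_le_of_lt (Nat.sub_le _ _) t.isLt⟩
    M.trans (τ u).1 (τ u).2 (τ t).1

/-- The trajectory density `p_θ(τ)`. -/
def trajDensity (M : MDP S A T) (pol : Param d → S → A → ℝ) (θ : Param d) (τ : Traj S A T) : ℝ :=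
  (∏ t : Fin T, stateDensity M τ t) * ∏ t : Fin T, pol θ (τ t).1 (τ t).2

/-- Reference measure on trajectories. -/
def trajRef (M : MDP S A T) : Measure (Traj S A T) :=
  Measure.pi fun _ : Fin T => M.refS.prod M.refA

/-- The law of a trajectory collected with the policy of parameter `θ`. -/
def trajLaw (M : MDP S A T) (pol : Param d → S → A → ℝ) (θ : Param d) :
    Measure (Traj S A T) :=
  (trajRef M).withDensity fun τ => ENNReal.ofReal (trajDensity M pol θ τ)

/-- Expected return `J(θ)`. -/
def J (M : MDP S A T) (pol : Param d → S → A → ℝ) (θ : Param d) : ℝ :=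
  ∫ τ, ret M τ ∂(trajLaw M pol θ)

/-- The score `∇_θ log π_θ(a | s)`. -/
def score (pol : Param d → S → A → ℝ) (s : S) (a : A) (θ : Param d) : Param d :=
  gradient (fun θ' => Real.log (pol θ' s a)) θ

/-- The two single-trajectory policy gradient estimators. -/
inductive EstimatorKind
  | reinforce
  | gpomdp

/-- The single-trajectory gradient estimator `g_θ(τ)`. -/
def singleEstim (M : MDP S A T) (pol : Param d → S → A → ℝ) (τ : Traj S A T) :
    EstimatorKind → Param d → Param d
  | .reinforce, θ => ret M τ • ∑ t : Fin T, score pol (τ t).1 (τ t).2 θ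
  | .gpomdp, θ => ∑ t : Fin T,
      (M.discount ^ (t : ℕ) * M.reward (τ t).1 (τ t).2) •
        ∑ l ∈ Finset.univ.filter (fun l : Fin T => l ≤ t), score pol (τ l).1 (τ l).2 θ

/-- Regularity of `log π_θ`: for all `θ ∈ Θ`, `s`, `a`, the function `θ ↦ log π_θ(a | s)` is defined
and twice differentiable, its gradient is bounded by `L₁` and its Hessian by `L₂`. -/
structure LogPolicyRegular (Θ : Set (Param d)) (pol : Param d → S → A → ℝ) (L₁ L₂ : ℝ) :
    Prop where
  L₁_pos : 0 < L₁
  L₂_pos : 0 < L₂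
  pol_pos : ∀ θ ∈ Θ, ∀ s a, 0 < pol θ s a
  differentiable_log : ∀ θ ∈ Θ, ∀ s a, DifferentiableAt ℝ (fun θ' => Real.log (pol θ' s a)) θ
  differentiable_score : ∀ θ ∈ Θ, ∀ s a, DifferentiableAt ℝ (score pol s a) θ
  norm_score_le : ∀ θ ∈ Θ, ∀ s a, ‖score pol s a θ‖ ≤ L₁
  norm_hessian_le : ∀ θ ∈ Θ, ∀ s a, ‖fderiv ℝ (score pol s a) θ‖ ≤ L₂

/-- The `χ²`-divergence `∫ p² / q - 1` of two probability densities with `p = 0` where `q = 0`. -/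
def chiSq {X : Type*} [MeasurableSpace X] (ν : Measure X) (p q : X → ℝ) : ENNReal :=
  ∫⁻ x, ENNReal.ofReal (p x ^ 2 / q x) ∂ν - 1

/-- Uniformly bounded `χ²`-divergence between trajectory distributions. -/
structure BoundedChiSq (M : MDP S A T) (Θ : Set (Param d)) (pol : Param d → S → A → ℝ) (D : ℝ) :
    Prop where
  one_le : 1 ≤ D
  chiSq_le : ∀ θ₁ ∈ Θ, ∀ θ₂ ∈ Θ,
    chiSq (trajRef M) (trajDensity M pol θ₁) (trajDensity M pol θ₂) ≤ ENNReal.ofReal (D - 1)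

/-- `G` and `G₂` are positive uniform bounds on `g_θ(τ)` and on its Jacobian in `θ`. -/
structure EstimatorBounds (M : MDP S A T) (Θ : Set (Param d)) (pol : Param d → S → A → ℝ)
    (e : EstimatorKind) (G G₂ : ℝ) : Prop where
  G_pos : 0 < G
  G₂_pos : 0 < G₂
  norm_le : ∀ θ ∈ Θ, ∀ τ, ‖singleEstim M pol τ e θ‖ ≤ G
  norm_fderiv_le : ∀ θ ∈ Θ, ∀ τ, ‖fderiv ℝ (singleEstim M pol τ e) θ‖ ≤ G₂

/-- Effective window size `ω_k = min {ω, k}`. -/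
def win (w k : ℕ) : ℕ := min w k

/-- First iteration of the window, `k₀ = k - ω_k + 1`. -/
def winStart (w k : ℕ) : ℕ := k - win w k + 1

/-- The multiple power mean estimate at iteration `k` of the gradient of `J` at `target`, from the
parameters `θ i` and the trajectories `τ i j` of the window. -/
def mpm (M : MDP S A T) (pol : Param d → S → A → ℝ) (e : EstimatorKind) {N : ℕ} (w : ℕ)
    (α lam : ℕ → ℕ → ℝ) (θ : ℕ → Param d) (τ : ℕ → Fin N → Traj S A T) (k : ℕ)
    (target : Param d) : Param d :=
  ∑ i ∈ Finset.Icc (winStart w k) k, (1 / (N : ℝ)) • ∑ j : Fin N,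
    (α i k / ((1 - lam i k) * (trajDensity M pol (θ i) (τ i j) / trajDensity M pol target (τ i j))
      + lam i k)) • singleEstim M pol (τ i j) e target

/-- The σ-algebra generated by `θ₁, (τ_{1,j})_j, …, θ_{i-1}, (τ_{i-1,j})_j, θ_i`. -/
abbrev pastSigma {Ω : Type*} {N : ℕ} (θ : ℕ → Ω → Param d) (τ : ℕ → Fin N → Ω → Traj S A T)
    (i : ℕ) : MeasurableSpace Ω :=
  (⨆ z ∈ Finset.Icc 1 i, MeasurableSpace.comap (θ z) inferInstance) ⊔
    ⨆ z ∈ Finset.Ico 1 i, MeasurableSpace.comap (fun x (j : Fin N) => τ z j x) inferInstance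

/-- The random variables `θ i`, `τ i j` (`1 ≤ i ≤ k`, `j < N`) form a history of `k` iterations of
the algorithm: the iterates lie in `Θ`; given the past up to `θ i`, the `N` trajectories of
iteration `i` are independent with law `p_{θ i}`; and the next parameter is obtained by a gradient
ascent step of size `ζ i` along the multiple power mean estimate. -/
structure IsHistory (M : MDP S A T) (Θ : Set (Param d)) (pol : Param d → S → A → ℝ)
    (e : EstimatorKind) {N : ℕ} (w : ℕ) (α lam : ℕ → ℕ → ℝ) (ζ : ℕ → ℝ) (k : ℕ)
    {Ω : Type*} [MeasurableSpace Ω] (P : Measure Ω)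
    (θ : ℕ → Ω → Param d) (τ : ℕ → Fin N → Ω → Traj S A T) : Prop where
  measurable_param : ∀ i ∈ Finset.Icc 1 k, Measurable (θ i)
  measurable_traj : ∀ i ∈ Finset.Icc 1 k, ∀ j, Measurable (τ i j)
  param_mem : ∀ i ∈ Finset.Icc 1 k, ∀ᵐ x ∂P, θ i x ∈ Θ
  sampling : ∀ i ∈ Finset.Icc 1 k, ∀ F : Set Ω, MeasurableSet[pastSigma θ τ i] F →
    ∀ B : Set (Fin N → Traj S A T), MeasurableSet B →
      P (F ∩ {x | (fun j => τ i j x) ∈ B}) =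
        ∫⁻ x in F, Measure.pi (fun _ : Fin N => trajLaw M pol (θ i x)) B ∂P
  update : ∀ i ∈ Finset.Ico 1 k, ∀ᵐ x ∂P,
    θ (i + 1) x = θ i x +
      ζ i • mpm M pol e w α lam (fun z => θ z x) (fun z j => τ z j x) i (θ i x)

/-- The largest step size in the window before iteration `k`; it is `0` if the window consists of
iteration `k` only. -/
def maxStep (ζ : ℕ → ℝ) (w k : ℕ) : ℝ := sSup (ζ '' Set.Ico (winStart w k) k)

/-- The logarithmic factor
`log (6 + (G T L₁ + G₂) (1 + √(3/4 D N ω_k)) 3√3 ζ̄_k ω_k² N / (4 √d))`. -/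
def logFactor (d T N w k : ℕ) (D G G₂ L₁ : ℝ) (ζ : ℕ → ℝ) : ℝ :=
  Real.log (6 + (G * T * L₁ + G₂) * (1 + √(3 / 4 * D * N * win w k)) *
    (3 * √3 * maxStep ζ w k * (win w k : ℝ) ^ 2 * N / (4 * √d)))

/-- The effective complexity `d · logFactor + log (1/δ)`, i.e. `d + log (1/δ)` up to the
logarithmic factor. -/
def complexity (d T N w k : ℕ) (D G G₂ L₁ : ℝ) (ζ : ℕ → ℝ) (δ : ℝ) : ℝ :=
  d * logFactor d T N w k D G G₂ L₁ ζ + Real.log (1 / δ)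

/-- The coefficient prescribed for a history-independent target at confidence level `δ`. -/
def lamIndep (d N w k : ℕ) (D δ : ℝ) : ℝ :=
  √(4 * (d * Real.log 6 + Real.log (1 / δ)) / (3 * D * N * win w k))

/-- The coefficient prescribed for the history-dependent target at confidence level `δ`. -/
def lamDep (d T N w k : ℕ) (D G G₂ L₁ : ℝ) (ζ : ℕ → ℝ) (δ : ℝ) : ℝ :=
  √(4 * complexity d T N w k D G G₂ L₁ ζ δ / (3 * D * N * win w k))

end RPG

end

open MeasureTheory

noncomputable section

namespace RPG

/-! Fix a target `y` and a direction `u` in the unit ball. A sample from `p_t` enters with weight `b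
/ ((1-λ)a + λb)`, where `a = p_t` and `b = p_y`. This weight is at most `1/λ`. By the `χ²` bound,
the weighted estimator `⟨u, g_y⟩` has bias at most `2GλD` and second moment at most `G²D`. Hence
`λ/G` times its deviation from the mean of `⟨u, g_y⟩` under `p_y` has exponential moment at most
`exp (11/4 λ² D)` (`integral_exp_weightedEstim_le`). If `y` is determined by the first parameter of
the window, the normalised exponentials multiply to a supermartingale along the batches, and
Markov's inequality gives a tail `exp (-C)` (`IsHistory.measure_deviation_le`). A half-net of at
most `5^d` directions turns this into a bound on the norm, and unbiasedness (`hasGradientAt_J`)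
identifies the mean with `∇J(y)`.

The difficulty is that the true target `θ_k` depends on the batches of the window. Bounded weights
help a second time: every update in the window has length at most `ζ̄ G / λ`, so `θ_k - θ_{k₀}` lies
almost surely in a ball of deterministic radius (`norm_param_sub_le_windowRadius`). Cover this ball
by an `η`-net. For each net vector `v`, a measurable choice of a point of `Θ` near `θ_{k₀} + v`
(`exists_measurable_selection`) is an admissible target. A union bound over pairs `(u, v)` costs at
most `(6 + coverTerm)^d`, which the definition of `complexity` absorbs (`net_card_numeric`,
`exp_neg_complexity`).

It remains to move from the net target back to `θ_k`. Since `log p_y` is Lipschitz in `y`, so are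
the estimate and its mean, with constants `Q/λ` and `Q` for `Q = G T L₁ + G₂` (`norm_mpm_sub_le`,
`norm_meanEstim_sub_le`). In units of `G √(D C / (N ω_k))`, concentration costs `8.1` and the change
of target `7.8`, together less than `16`. -/

/-! ### Nets in balls and elementary inequalities -/

/-- Volume bound for the cardinality of an `η`-separated set in a ball of radius `R`. -/
theorem card_le_of_separated {E : Type*} [NormedAddCommGroup E] [NormedSpace ℝ E]
    [FiniteDimensional ℝ E] {R η : ℝ} (hR : 0 ≤ R) (hη : 0 < η) (s : Finset E)
    (hs : ∀ c ∈ s, ‖c‖ ≤ R) (h : ∀ c ∈ s, ∀ c' ∈ s, c ≠ c' → η ≤ dist c c') :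
    (s.card : ℝ) ≤ (1 + 2 * R / η) ^ Module.finrank ℝ E := by
  borelize E
  let μ : Measure E := Measure.addHaar
  have hη2 : 0 < η / 2 := by positivity
  have hρ : 0 < R + η / 2 := by positivity
  have hdisj : Set.Pairwise (s : Set E)
      (Function.onFun Disjoint fun c => Metric.ball (c : E) (η / 2)) := by
    intro c hc c' hc' hcc'
    apply Metric.ball_disjoint_ball
    have := h c hc c' hc' hcc'
    linarith
  have hsub : (⋃ c ∈ s, Metric.ball (c : E) (η / 2)) ⊆ Metric.ball (0 : E) (R + η / 2) := by
    refine Set.iUnion₂_subset fun x hx => Metric.ball_subset_ball' ?_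
    rw [dist_zero_right]
    linarith [hs x hx]
  have hvol : (s.card : ENNReal) * ENNReal.ofReal ((η / 2) ^ Module.finrank ℝ E) *
      μ (Metric.ball 0 1) ≤
      ENNReal.ofReal ((R + η / 2) ^ Module.finrank ℝ E) * μ (Metric.ball 0 1) := by
    calc _ = μ (⋃ c ∈ s, Metric.ball (c : E) (η / 2)) := by
          rw [measure_biUnion_finset hdisj fun c _ => measurableSet_ball]
          simp only [μ.addHaar_ball_of_pos _ hη2, Finset.sum_const, nsmul_eq_mul, mul_assoc]
      _ ≤ μ (Metric.ball (0 : E) (R + η / 2)) := measure_mono hsub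
      _ = _ := by simp only [μ.addHaar_ball_of_pos _ hρ]
  have hcard : (s.card : ENNReal) * ENNReal.ofReal ((η / 2) ^ Module.finrank ℝ E) ≤
      ENNReal.ofReal ((R + η / 2) ^ Module.finrank ℝ E) :=
    (ENNReal.mul_le_mul_iff_left (Metric.measure_ball_pos _ _ zero_lt_one).ne'
      measure_ball_lt_top.ne).1 hvol
  have hreal := ENNReal.toReal_le_of_le_ofReal (pow_nonneg hρ.le _) hcard
  rw [ENNReal.toReal_mul, ENNReal.toReal_natCast,
    ENNReal.toReal_ofReal (pow_nonneg hη2.le _)] at hreal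
  have hratio : 1 + 2 * R / η = (R + η / 2) / (η / 2) := by field_simp; ring
  rw [hratio, div_pow, le_div_iff₀ (by positivity)]
  exact hreal

/-- A ball of radius `R` has an `η`-net of at most `(1 + 2R/η)^d` of its points. -/
theorem exists_net {E : Type*} [NormedAddCommGroup E] [NormedSpace ℝ E]
    [FiniteDimensional ℝ E] {R η : ℝ} (hR : 0 ≤ R) (hη : 0 < η) :
    ∃ V : Finset E, (∀ v ∈ V, ‖v‖ ≤ R) ∧ (∀ x : E, ‖x‖ ≤ R → ∃ v ∈ V, dist x v < η) ∧
      (V.card : ℝ) ≤ (1 + 2 * R / η) ^ Module.finrank ℝ E := by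
  classical
  -- A separated set of maximal size is a net, since an uncovered point could be added to it. The
  -- volume bound makes the maximum exist.
  let p : ℕ → Prop := fun m => ∃ V : Finset E, V.card = m ∧ (∀ v ∈ V, ‖v‖ ≤ R) ∧
    ∀ c ∈ V, ∀ c' ∈ V, c ≠ c' → η ≤ dist c c'
  have hbd : ∀ m, p m → m ≤ ⌈(1 + 2 * R / η) ^ Module.finrank ℝ E⌉₊ := by
    rintro m ⟨V, rfl, h1, h2⟩
    exact_mod_cast (card_le_of_separated hR hη V h1 h2).trans (Nat.le_ceil _)
  have hp0 : p 0 := ⟨∅, by simp⟩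
  have hp := Nat.findGreatest_spec (P := p)
    (Nat.zero_le ⌈(1 + 2 * R / η) ^ Module.finrank ℝ E⌉₊) hp0
  obtain ⟨V, hV, h1, h2⟩ := hp
  refine ⟨V, h1, fun x hx => ?_, card_le_of_separated hR hη V h1 h2⟩
  by_contra! hcon
  have hxV : x ∉ V := fun hxV => by
    have := hcon x hxV
    rw [dist_self] at this
    linarith
  have hins : p (V.card + 1) := by
    refine ⟨insert x V, Finset.card_insert_of_notMem hxV, ?_, ?_⟩
    · intro v hv
      rcases Finset.mem_insert.1 hv with rfl | hv
      exacts [hx, h1 v hv]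
    · intro c hc c' hc' hne
      rcases Finset.mem_insert.1 hc with rfl | hcV <;>
        rcases Finset.mem_insert.1 hc' with rfl | hcV'
      · exact absurd rfl hne
      · exact hcon c' hcV'
      · rw [dist_comm]; exact hcon c hcV
      · exact h2 c hcV c' hcV' hne
  have := Nat.le_findGreatest (hbd _ hins) hins
  omega

/-- The norm is controlled by finitely many directions forming a half-net of the unit ball. -/
theorem norm_le_two_mul_of_inner_le {E : Type*} [NormedAddCommGroup E] [InnerProductSpace ℝ E]
    {U : Finset E} (hU : ∀ x : E, ‖x‖ ≤ 1 → ∃ v ∈ U, dist x v < 1 / 2) {z : E} {B : ℝ}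
    (h : ∀ v ∈ U, inner ℝ v z ≤ B) : ‖z‖ ≤ 2 * B := by
  rcases eq_or_ne z 0 with rfl | hz
  · obtain ⟨v, hv, -⟩ := hU 0 (by simp)
    have := h v hv
    rw [inner_zero_right] at this
    simpa using this
  have hz' : 0 < ‖z‖ := norm_pos_iff.2 hz
  set x : E := ‖z‖⁻¹ • z with hx
  have hx1 : ‖x‖ = 1 := by rw [hx, norm_smul, norm_inv, norm_norm, inv_mul_cancel₀ hz'.ne']
  obtain ⟨v, hv, hd⟩ := hU x hx1.le
  have h1 : inner ℝ x z = ‖z‖ := by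
    rw [hx, real_inner_smul_left, real_inner_self_eq_norm_sq]
    field_simp
  -- Replacing the unit vector along `z` by its net point loses at most half of `‖z‖`; this is the
  -- source of the factor `2`.
  have h2 : inner ℝ (x - v) z ≤ 1 / 2 * ‖z‖ :=
    (real_inner_le_norm _ _).trans (by rw [← dist_eq_norm]; gcongr)
  rw [inner_sub_left, h1] at h2
  linarith [h v hv]

/-- Taylor's formula with cubic remainder `2/9 |x|³`, and `1/2 + 2/9 ≤ 3/4`. The `3/4` is the
constant behind the `4/3` in the prescribed coefficients. -/
theorem exp_le_quadratic {x : ℝ} (hx : |x| ≤ 1) : Real.exp x ≤ 1 + x + 3 / 4 * x ^ 2 := by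
  have h := Real.exp_bound hx (n := 3) (by norm_num)
  norm_num [Finset.sum_range_succ, Nat.factorial] at h
  have h3 : |x| ^ 3 ≤ x ^ 2 := by
    rw [← sq_abs x]
    nlinarith [abs_nonneg x, sq_nonneg |x|]
  have := (abs_le.1 h).2
  nlinarith

/-- Follows from `2^5 ≤ 6^2`. The precision matters: `1.70` would be too small in
`net_radius_numeric`. -/
theorem log_six_ge : (1.73 : ℝ) ≤ Real.log 6 := by
  have h : 5 * Real.log 2 ≤ 2 * Real.log 6 := by
    rw [← Real.log_rpow (by norm_num), ← Real.log_rpow (by norm_num)]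
    apply Real.log_le_log <;> norm_num
  linarith [Real.log_two_gt_d9]

variable {S A : Type*} [MeasurableSpace S] [MeasurableSpace A] {T d : ℕ}

/-! ### Trajectory densities of time-dependent policies -/

/-- A time-dependent Markov policy given by densities. -/
structure IsPolicySeq (M : MDP S A T) (q : Fin T → S → A → ℝ) : Prop where
  measurable : ∀ t, Measurable fun x : S × A => q t x.1 x.2
  nonneg : ∀ t s a, 0 ≤ q t s a
  lintegral_eq_one : ∀ t s, ∫⁻ a, ENNReal.ofReal (q t s a) ∂M.refA = 1

/-- The trajectory density of a time-dependent policy. -/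
def pathDensity (M : MDP S A T) (q : Fin T → S → A → ℝ) (τ : Traj S A T) : ℝ :=
  (∏ t : Fin T, stateDensity M τ t) * ∏ t : Fin T, q t (τ t).1 (τ t).2

/-- The factor contributed to the trajectory density by step `t`. -/
def stepWeight (M : MDP S A T) (q : Fin T → S → A → ℝ) (t : Fin T) (τ : Traj S A T) : ENNReal :=
  ENNReal.ofReal (stateDensity M τ t) * ENNReal.ofReal (q t (τ t).1 (τ t).2)

theorem stateDensity_nonneg (M : MDP S A T) (τ : Traj S A T) (t : Fin T) :
    0 ≤ stateDensity M τ t := by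
  unfold stateDensity
  split_ifs
  · exact M.init_nonneg _
  · exact M.trans_nonneg _ _ _

theorem measurable_stateDensity (M : MDP S A T) (t : Fin T) :
    Measurable fun τ : Traj S A T => stateDensity M τ t := by
  unfold stateDensity
  split_ifs
  · exact M.init_measurable.comp (measurable_pi_apply t).fst
  · exact M.trans_measurable.comp ((measurable_pi_apply _).fst.prodMk
      ((measurable_pi_apply _).snd.prodMk (measurable_pi_apply t).fst))

theorem measurable_stepWeight {M : MDP S A T} {q : Fin T → S → A → ℝ} (hq : IsPolicySeq M q)
    (t : Fin T) : Measurable (stepWeight M q t) :=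
  (measurable_stateDensity M t).ennreal_ofReal.mul
    ((hq.measurable t).comp (measurable_pi_apply t)).ennreal_ofReal

theorem ofReal_pathDensity {M : MDP S A T} {q : Fin T → S → A → ℝ} (hq : IsPolicySeq M q)
    (τ : Traj S A T) : ENNReal.ofReal (pathDensity M q τ) = ∏ t, stepWeight M q t τ := by
  unfold pathDensity stepWeight
  rw [ENNReal.ofReal_mul (Finset.prod_nonneg fun t _ => stateDensity_nonneg M τ t),
    ENNReal.ofReal_prod_of_nonneg fun t _ => stateDensity_nonneg M τ t,
    ENNReal.ofReal_prod_of_nonneg fun t _ => hq.nonneg t _ _, Finset.prod_mul_distrib]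

theorem pathDensity_nonneg {M : MDP S A T} {q : Fin T → S → A → ℝ} (hq : IsPolicySeq M q)
    (τ : Traj S A T) : 0 ≤ pathDensity M q τ :=
  mul_nonneg (Finset.prod_nonneg fun t _ => stateDensity_nonneg M τ t)
    (Finset.prod_nonneg fun t _ => hq.nonneg t _ _)

theorem measurable_pathDensity {M : MDP S A T} {q : Fin T → S → A → ℝ} (hq : IsPolicySeq M q) :
    Measurable (pathDensity M q) :=
  (Finset.measurable_fun_prod _ fun t _ => measurable_stateDensity M t).mul
    (Finset.measurable_fun_prod _ fun t _ => (hq.measurable t).comp (measurable_pi_apply t))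

/-- Given the other steps, the factor of step `t` is a probability density in its own coordinate:
integrate the action first, then the state. -/
theorem lintegral_stepWeight_update {M : MDP S A T} {q : Fin T → S → A → ℝ} (hq : IsPolicySeq M q)
    (t : Fin T) (τ : Traj S A T) :
    ∫⁻ x, stepWeight M q t (Function.update τ t x) ∂(M.refS.prod M.refA) = 1 := by
  have := M.sigmaFinite_refS
  have := M.sigmaFinite_refA
  have key : ∀ f : S → ℝ, Measurable f → ∫⁻ s, ENNReal.ofReal (f s) ∂M.refS = 1 →
      ∫⁻ x : S × A, ENNReal.ofReal (f x.1) * ENNReal.ofReal (q t x.1 x.2)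
        ∂(M.refS.prod M.refA) = 1 := by
    intro f hf h1
    rw [lintegral_prod _ (by
      exact ((hf.comp measurable_fst).ennreal_ofReal.mul
        (hq.measurable t).ennreal_ofReal).aemeasurable)]
    have hqt : ∀ s, Measurable fun a => ENNReal.ofReal (q t s a) := fun s =>
      ((hq.measurable t).comp measurable_prodMk_left).ennreal_ofReal
    simp only [lintegral_const_mul _ (hqt _), hq.lintegral_eq_one, mul_one, h1]
  unfold stepWeight stateDensity
  by_cases ht : (t : ℕ) = 0
  · simp only [ht, if_true, Function.update_self]
    exact key _ M.init_measurable M.lintegral_init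
  · have hne : (⟨(t : ℕ) - 1, lt_of_le_of_lt (Nat.sub_le _ _) t.isLt⟩ : Fin T) ≠ t := by
      intro h
      have := congrArg Fin.val h
      simp at this
      omega
    simp only [ht, if_false, Function.update_self, Function.update_of_ne hne]
    exact key _ (M.trans_measurable.comp
      (measurable_const.prodMk (measurable_const.prodMk measurable_id))) (M.lintegral_trans _ _)

theorem stepWeight_update_of_lt {M : MDP S A T} {q : Fin T → S → A → ℝ} {t u : Fin T}
    (h : t < u) (τ : Traj S A T) (x : S × A) :
    stepWeight M q t (Function.update τ u x) = stepWeight M q t τ := by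
  have h1 : t ≠ u := h.ne
  -- The factor of step `t` reads only coordinates `t - 1` and `t`. For `t = 0` the truncated
  -- predecessor is `0`, which is still below `u`.
  have h2 : (⟨(t : ℕ) - 1, lt_of_le_of_lt (Nat.sub_le _ _) t.isLt⟩ : Fin T) ≠ u := by
    intro h'
    have := congrArg Fin.val h'
    have := Fin.lt_def.1 h
    simp at *
    omega
  unfold stepWeight stateDensity
  simp only [Function.update_of_ne h1, Function.update_of_ne h2]

/-- Integrating out the steps from `m` on removes their factors. -/
theorem lmarginal_tail {M : MDP S A T} {q : Fin T → S → A → ℝ} (hq : IsPolicySeq M q)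
    {φ : Traj S A T → ENNReal} (hφ : Measurable φ) (m : ℕ)
    (hdep : ∀ t : Fin T, m ≤ t → ∀ τ x, φ (Function.update τ t x) = φ τ) :
    lmarginal (fun _ : Fin T => M.refS.prod M.refA) (Finset.univ.filter fun t : Fin T => m ≤ t)
      (fun τ => φ τ * ∏ t, stepWeight M q t τ) =
    fun τ => φ τ * ∏ t ∈ Finset.univ.filter (fun t : Fin T => (t : ℕ) < m), stepWeight M q t τ := by
  have := M.sigmaFinite_refS
  have := M.sigmaFinite_refA
  have hmeas : Measurable fun τ => φ τ * ∏ t, stepWeight M q t τ :=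
    hφ.mul (Finset.measurable_fun_prod _ fun t _ => measurable_stepWeight hq t)
  by_cases hm : T ≤ m
  · have h1 : (Finset.univ.filter fun t : Fin T => m ≤ t) = ∅ := by
      ext t; simp; omega
    have h2 : (Finset.univ.filter fun t : Fin T => (t : ℕ) < m) = Finset.univ := by
      ext t; simp; omega
    rw [h1, h2, lmarginal_empty]
  · push Not at hm
    let i : Fin T := ⟨m, hm⟩
    have h1 : (Finset.univ.filter fun t : Fin T => m ≤ t) =
        insert i (Finset.univ.filter fun t : Fin T => m + 1 ≤ t) := by
      ext t; simp [i, Fin.ext_iff]; omega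
    have h2 : (Finset.univ.filter fun t : Fin T => (t : ℕ) < m + 1) =
        insert i (Finset.univ.filter fun t : Fin T => (t : ℕ) < m) := by
      ext t; simp [i, Fin.ext_iff]; omega
    have hi1 : i ∉ Finset.univ.filter fun t : Fin T => m + 1 ≤ t := by simp [i]
    have hi2 : i ∉ Finset.univ.filter fun t : Fin T => (t : ℕ) < m := by simp [i]
    -- Induction from the last step backwards: once the steps after `m` are gone, coordinate `m`
    -- occurs only in its own factor, which integrates to one.
    have ih := lmarginal_tail hq hφ (m + 1) fun t ht => hdep t (by omega)
    funext τ
    rw [h1, lmarginal_insert _ hmeas hi1, ih, h2]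
    have hstep : ∀ x, φ (Function.update τ i x) *
        ∏ t ∈ insert i (Finset.univ.filter fun t : Fin T => (t : ℕ) < m),
          stepWeight M q t (Function.update τ i x) =
        (φ τ * ∏ t ∈ Finset.univ.filter (fun t : Fin T => (t : ℕ) < m), stepWeight M q t τ) *
          stepWeight M q i (Function.update τ i x) := by
      intro x
      have hprod : ∏ t ∈ Finset.univ.filter (fun t : Fin T => (t : ℕ) < m),
          stepWeight M q t (Function.update τ i x) =
          ∏ t ∈ Finset.univ.filter (fun t : Fin T => (t : ℕ) < m), stepWeight M q t τ :=
        Finset.prod_congr rfl fun t ht =>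
          stepWeight_update_of_lt (u := i) (Finset.mem_filter.1 ht).2 τ x
      rw [hdep i le_rfl, Finset.prod_insert hi2, hprod]
      ring
    simp only [hstep]
    have hupd : Measurable fun x => stepWeight M q i (Function.update τ i x) :=
      (measurable_stepWeight hq i).comp (measurable_update τ)
    rw [lintegral_const_mul _ hupd,
      lintegral_stepWeight_update hq, mul_one]
termination_by T - m

instance sigmaFinite_trajRef (M : MDP S A T) : SigmaFinite (trajRef M) := by
  have := M.sigmaFinite_refS
  have := M.sigmaFinite_refA
  unfold trajRef
  infer_instance

theorem lintegral_pathDensity {M : MDP S A T} {q : Fin T → S → A → ℝ} (hq : IsPolicySeq M q) :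
    ∫⁻ τ, ENNReal.ofReal (pathDensity M q τ) ∂(trajRef M) = 1 := by
  have := M.sigmaFinite_refS
  have := M.sigmaFinite_refA
  have h := lmarginal_tail hq (φ := fun _ => 1) measurable_const 0 (fun _ _ _ _ => rfl)
  simp only [zero_le, Finset.filter_true, one_mul, not_lt_zero, Finset.filter_false,
    Finset.prod_empty] at h
  -- `lintegral_eq_lmarginal_univ` needs a base trajectory. One exists: for `T = 0` trivially,
  -- otherwise because an empty `S` or `A` would contradict the normalisation of the densities.
  rcases isEmpty_or_nonempty (Traj S A T) with hE | ⟨⟨τ⟩⟩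
  · exfalso
    have hT : 0 < T := by
      by_contra hT
      have : T = 0 := by omega
      subst this
      exact hE.elim Fin.elim0
    by_cases hS : Nonempty S
    · obtain ⟨s⟩ := hS
      by_cases hA : Nonempty A
      · obtain ⟨a⟩ := hA
        exact hE.elim fun _ => (s, a)
      · rw [not_nonempty_iff] at hA
        have := hq.lintegral_eq_one ⟨0, hT⟩ s
        simp at this
    · rw [not_nonempty_iff] at hS
      have := M.lintegral_init
      simp at this
  · simp only [ofReal_pathDensity hq]
    rw [trajRef, lintegral_eq_lmarginal_univ τ, h]

/-- The expectation of a function of the first `m` steps depends on the first `m` policies only. -/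
theorem lintegral_pathDensity_congr {M : MDP S A T} {q q' : Fin T → S → A → ℝ}
    (hq : IsPolicySeq M q) (hq' : IsPolicySeq M q')
    {φ : Traj S A T → ENNReal} (hφ : Measurable φ) (m : ℕ)
    (hdep : ∀ t : Fin T, m ≤ t → ∀ τ x, φ (Function.update τ t x) = φ τ)
    (hqq' : ∀ t : Fin T, (t : ℕ) < m → q t = q' t) :
    ∫⁻ τ, φ τ * ENNReal.ofReal (pathDensity M q τ) ∂(trajRef M) =
      ∫⁻ τ, φ τ * ENNReal.ofReal (pathDensity M q' τ) ∂(trajRef M) := by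
  have := M.sigmaFinite_refS
  have := M.sigmaFinite_refA
  have hmeas : ∀ {q}, IsPolicySeq M q → Measurable fun τ => φ τ * ∏ t, stepWeight M q t τ :=
    fun hq => hφ.mul (Finset.measurable_fun_prod _ fun t _ => measurable_stepWeight hq t)
  simp only [ofReal_pathDensity hq, ofReal_pathDensity hq']
  refine lintegral_eq_of_lmarginal_eq _ (hmeas hq) (hmeas hq')
    ((lmarginal_tail hq hφ m hdep).trans (Eq.trans ?_ (lmarginal_tail hq' hφ m hdep).symm))
  funext τ
  congr 1
  refine Finset.prod_congr rfl fun t ht => ?_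
  unfold stepWeight
  rw [hqq' t (by simpa using ht)]

theorem integrable_pathDensity {M : MDP S A T} {q : Fin T → S → A → ℝ} (hq : IsPolicySeq M q) :
    Integrable (pathDensity M q) (trajRef M) := by
  refine ⟨(measurable_pathDensity hq).aestronglyMeasurable, ?_⟩
  rw [hasFiniteIntegral_iff_ofReal (ae_of_all _ (pathDensity_nonneg hq)), lintegral_pathDensity hq]
  exact ENNReal.one_lt_top

theorem integral_pathDensity {M : MDP S A T} {q : Fin T → S → A → ℝ} (hq : IsPolicySeq M q) :
    ∫ τ, pathDensity M q τ ∂(trajRef M) = 1 := by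
  rw [integral_eq_lintegral_of_nonneg_ae (ae_of_all _ (pathDensity_nonneg hq))
    (measurable_pathDensity hq).aestronglyMeasurable, lintegral_pathDensity hq, ENNReal.toReal_one]

theorem integrable_mul_pathDensity {M : MDP S A T} {q : Fin T → S → A → ℝ} (hq : IsPolicySeq M q)
    {h : Traj S A T → ℝ} (hh : Measurable h) {c : ℝ} (hc : ∀ τ, |h τ| ≤ c) :
    Integrable (fun τ => h τ * pathDensity M q τ) (trajRef M) :=
  (integrable_pathDensity hq).bdd_mul hh.aestronglyMeasurable (ae_of_all _ hc)

theorem integral_pathDensity_congr {M : MDP S A T} {q q' : Fin T → S → A → ℝ}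
    (hq : IsPolicySeq M q) (hq' : IsPolicySeq M q')
    {h : Traj S A T → ℝ} (hh : Measurable h) {c : ℝ} (hc : ∀ τ, |h τ| ≤ c) (m : ℕ)
    (hdep : ∀ t : Fin T, m ≤ t → ∀ τ x, h (Function.update τ t x) = h τ)
    (hqq' : ∀ t : Fin T, (t : ℕ) < m → q t = q' t) :
    ∫ τ, h τ * pathDensity M q τ ∂(trajRef M) = ∫ τ, h τ * pathDensity M q' τ ∂(trajRef M) := by
  -- Shifting `h` by its bound makes the integrand nonnegative; the shift contributes exactly `c`
  -- because the density has mass one.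
  have key : ∀ {q}, IsPolicySeq M q → ∫ τ, h τ * pathDensity M q τ ∂(trajRef M) =
      (∫⁻ τ, ENNReal.ofReal (h τ + c) * ENNReal.ofReal (pathDensity M q τ) ∂(trajRef M)).toReal
        - c := by
    intro q hq
    have hnn : ∀ τ, 0 ≤ h τ + c := fun τ => by linarith [(abs_le.1 (hc τ)).1]
    have h1 : ∫ τ, (h τ + c) * pathDensity M q τ ∂(trajRef M) =
        ∫ τ, h τ * pathDensity M q τ ∂(trajRef M) + c := by
      simp only [add_mul]
      rw [integral_add (integrable_mul_pathDensity hq hh hc)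
        ((integrable_pathDensity hq).const_mul c), integral_const_mul, integral_pathDensity hq,
        mul_one]
    rw [← sub_eq_iff_eq_add.2 h1, integral_eq_lintegral_of_nonneg_ae
      (ae_of_all _ fun τ => mul_nonneg (hnn τ) (pathDensity_nonneg hq τ))
      ((hh.add_const c).mul (measurable_pathDensity hq)).aestronglyMeasurable]
    simp only [ENNReal.ofReal_mul (hnn _)]
  rw [key hq, key hq', lintegral_pathDensity_congr hq hq' (hh.add_const c).ennreal_ofReal m
    (fun t ht τ x => by rw [hdep t ht]) hqq']

/-! ### Regularity of the policy class and of the single-trajectory estimators -/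

/-- The parameter may vary with the step, as the mixed policies in the gradient computation require.
-/
theorem IsPolicyClass.isPolicySeq {M : MDP S A T} {Θ : Set (Param d)}
    {pol : Param d → S → A → ℝ} (hpol : IsPolicyClass M Θ pol) {θ : Fin T → Param d}
    (hθ : ∀ t, θ t ∈ Θ) : IsPolicySeq M fun t => pol (θ t) where
  measurable _ := hpol.measurable.comp (measurable_const.prodMk measurable_id)
  nonneg t s a := hpol.nonneg _ (hθ t) s a
  lintegral_eq_one t s := hpol.lintegral_eq_one _ (hθ t) s

theorem measurable_trajDensity_uncurry {M : MDP S A T} {Θ : Set (Param d)}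
    {pol : Param d → S → A → ℝ} (hpol : IsPolicyClass M Θ pol) :
    Measurable fun x : Param d × Traj S A T => trajDensity M pol x.1 x.2 := by
  unfold trajDensity
  refine Measurable.mul
    (Finset.measurable_fun_prod _ fun t _ => (measurable_stateDensity M t).comp measurable_snd)
    (Finset.measurable_fun_prod _ fun t _ => ?_)
  exact hpol.measurable.comp (measurable_fst.prodMk ((measurable_pi_apply t).comp measurable_snd))

theorem measurable_trajDensity {M : MDP S A T} {Θ : Set (Param d)}
    {pol : Param d → S → A → ℝ} (hpol : IsPolicyClass M Θ pol) (θ : Param d) :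
    Measurable (trajDensity M pol θ) :=
  (measurable_trajDensity_uncurry hpol).comp measurable_prodMk_left

theorem trajDensity_nonneg {M : MDP S A T} {Θ : Set (Param d)}
    {pol : Param d → S → A → ℝ} (hpol : IsPolicyClass M Θ pol) {θ : Param d} (hθ : θ ∈ Θ)
    (τ : Traj S A T) : 0 ≤ trajDensity M pol θ τ :=
  pathDensity_nonneg (hpol.isPolicySeq (θ := fun _ => θ) fun _ => hθ) τ

theorem integrable_trajDensity {M : MDP S A T} {Θ : Set (Param d)}
    {pol : Param d → S → A → ℝ} (hpol : IsPolicyClass M Θ pol) {θ : Param d} (hθ : θ ∈ Θ) :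
    Integrable (trajDensity M pol θ) (trajRef M) :=
  integrable_pathDensity (hpol.isPolicySeq (θ := fun _ => θ) fun _ => hθ)

theorem integral_trajDensity {M : MDP S A T} {Θ : Set (Param d)}
    {pol : Param d → S → A → ℝ} (hpol : IsPolicyClass M Θ pol) {θ : Param d} (hθ : θ ∈ Θ) :
    ∫ τ, trajDensity M pol θ τ ∂(trajRef M) = 1 :=
  integral_pathDensity (hpol.isPolicySeq (θ := fun _ => θ) fun _ => hθ)

theorem isProbabilityMeasure_trajLaw {M : MDP S A T} {Θ : Set (Param d)}
    {pol : Param d → S → A → ℝ} (hpol : IsPolicyClass M Θ pol) {θ : Param d} (hθ : θ ∈ Θ) :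
    IsProbabilityMeasure (trajLaw M pol θ) := by
  constructor
  rw [trajLaw, withDensity_apply _ MeasurableSet.univ, Measure.restrict_univ]
  exact lintegral_pathDensity (hpol.isPolicySeq (θ := fun _ => θ) fun _ => hθ)

theorem LogPolicyRegular.hasFDerivAt_log {S A : Type*} {Θ : Set (Param d)} {pol : Param d → S → A → ℝ}
    {L₁ L₂ : ℝ} (hreg : LogPolicyRegular Θ pol L₁ L₂) {θ : Param d} (hθ : θ ∈ Θ) (s : S) (a : A) :
    HasFDerivAt (fun θ' => Real.log (pol θ' s a))
      (InnerProductSpace.toDual ℝ (Param d) (score pol s a θ)) θ :=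
  hasGradientAt_iff_hasFDerivAt.1 (hreg.differentiable_log θ hθ s a).hasGradientAt

theorem LogPolicyRegular.abs_log_sub_le {S A : Type*} {Θ : Set (Param d)} {pol : Param d → S → A → ℝ}
    {L₁ L₂ : ℝ} (hreg : LogPolicyRegular Θ pol L₁ L₂) (hconv : Convex ℝ Θ) {θ θ' : Param d}
    (hθ : θ ∈ Θ) (hθ' : θ' ∈ Θ) (s : S) (a : A) :
    |Real.log (pol θ' s a) - Real.log (pol θ s a)| ≤ L₁ * ‖θ' - θ‖ :=
  Convex.norm_image_sub_le_of_norm_hasFDerivWithin_le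
    (f := fun θ => Real.log (pol θ s a))
    (fun x hx => (hreg.hasFDerivAt_log hx s a).hasFDerivWithinAt)
    (fun x hx => by rw [LinearIsometryEquiv.norm_map]; exact hreg.norm_score_le x hx s a)
    hconv hθ hθ'

/-- Joint measurability of the score on the parameter set. -/
theorem measurable_score_uncurry {M : MDP S A T} {Θ : Set (Param d)} (hΘ : IsOpen Θ)
    {pol : Param d → S → A → ℝ} (hpol : IsPolicyClass M Θ pol) {L₁ L₂ : ℝ}
    (hreg : LogPolicyRegular Θ pol L₁ L₂) :
    Measurable fun x : Param d × S × A =>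
      Θ.indicator (fun θ => score pol x.2.1 x.2.2 θ) x.1 := by
  classical
  let b := EuclideanSpace.basisFun (Fin d) ℝ
  have hinner : ∀ v : Param d, Measurable fun x : Param d × S × A =>
      inner ℝ v (Θ.indicator (fun θ => score pol x.2.1 x.2.2 θ) x.1) := by
    intro v
    -- Directional derivatives are limits of difference quotients, which are jointly measurable
    -- because `pol` is measurable on the whole parameter space. Convergence is known only on `Θ`,
    -- hence the indicator.
    let f : ℕ → Param d × S × A → ℝ := fun n x => Θ.indicator (fun θ => (n : ℝ) •
      (Real.log (pol (x.1 + (n : ℝ)⁻¹ • v) x.2.1 x.2.2) - Real.log (pol x.1 x.2.1 x.2.2))) x.1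
    have hset : MeasurableSet {x : Param d × S × A | x.1 ∈ Θ} := measurable_fst hΘ.measurableSet
    have hf : ∀ n, Measurable (f n) := by
      intro n
      have h1 : Measurable fun x : Param d × S × A => (n : ℝ) •
          (Real.log (pol (x.1 + (n : ℝ)⁻¹ • v) x.2.1 x.2.2) -
            Real.log (pol x.1 x.2.1 x.2.2)) := by
        have h2 : Measurable fun x : Param d × S × A =>
            Real.log (pol (x.1 + (n : ℝ)⁻¹ • v) x.2.1 x.2.2) :=
          (hpol.measurable.comp ((measurable_fst.add_const _).prodMk measurable_snd)).log
        exact (h2.sub hpol.measurable.log).const_smul (n : ℝ)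
      exact h1.indicator hset
    refine measurable_of_tendsto_metrizable hf (tendsto_pi_nhds.2 fun x => ?_)
    by_cases hx : x.1 ∈ Θ
    · simp only [f, Set.indicator_of_mem hx]
      have := (hreg.hasFDerivAt_log hx x.2.1 x.2.2).lim v (c := fun n : ℕ => (n : ℝ))
        (l := Filter.atTop) (by simpa using tendsto_natCast_atTop_atTop)
      rwa [InnerProductSpace.toDual_apply_apply, real_inner_comm] at this
    · simp only [f, Set.indicator_of_notMem hx, inner_zero_right]
      exact tendsto_const_nhds
  have hsum : (fun x : Param d × S × A => Θ.indicator (fun θ => score pol x.2.1 x.2.2 θ) x.1) =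
      fun x => ∑ i, inner ℝ (b i) (Θ.indicator (fun θ => score pol x.2.1 x.2.2 θ) x.1) • b i := by
    funext x
    rw [b.sum_repr']
  rw [hsum]
  exact Finset.measurable_fun_sum _ fun i _ => (hinner (b i)).smul_const _

theorem measurable_ret (M : MDP S A T) : Measurable (ret M) :=
  Finset.measurable_fun_sum _ fun t _ =>
    (M.reward_measurable.comp (measurable_pi_apply t)).const_mul _

/-- Joint measurability of the single-trajectory estimator on the parameter set. -/
theorem measurable_singleEstim_uncurry {M : MDP S A T} {Θ : Set (Param d)} (hΘ : IsOpen Θ)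
    {pol : Param d → S → A → ℝ} (hpol : IsPolicyClass M Θ pol) {L₁ L₂ : ℝ}
    (hreg : LogPolicyRegular Θ pol L₁ L₂) (e : EstimatorKind) :
    Measurable fun x : Param d × Traj S A T =>
      Θ.indicator (fun θ => singleEstim M pol x.2 e θ) x.1 := by
  classical
  have hsc : ∀ t : Fin T, Measurable fun x : Param d × Traj S A T =>
      Θ.indicator (fun θ => score pol (x.2 t).1 (x.2 t).2 θ) x.1 := fun t =>
    (measurable_score_uncurry hΘ hpol hreg).comp
      (measurable_fst.prodMk ((measurable_pi_apply t).comp measurable_snd))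
  cases e with
  | reinforce =>
    have : (fun x : Param d × Traj S A T =>
        Θ.indicator (fun θ => singleEstim M pol x.2 .reinforce θ) x.1) =
        fun x => ret M x.2 • ∑ t, Θ.indicator (fun θ => score pol (x.2 t).1 (x.2 t).2 θ) x.1 := by
      funext x
      by_cases hx : x.1 ∈ Θ <;> simp [hx, singleEstim]
    rw [this]
    exact ((measurable_ret M).comp measurable_snd).smul
      (Finset.measurable_fun_sum _ fun t _ => hsc t)
  | gpomdp =>
    have : (fun x : Param d × Traj S A T =>
        Θ.indicator (fun θ => singleEstim M pol x.2 .gpomdp θ) x.1) =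
        fun x => ∑ t : Fin T, (M.discount ^ (t : ℕ) * M.reward (x.2 t).1 (x.2 t).2) •
          ∑ l ∈ Finset.univ.filter (fun l : Fin T => l ≤ t),
            Θ.indicator (fun θ => score pol (x.2 l).1 (x.2 l).2 θ) x.1 := by
      funext x
      by_cases hx : x.1 ∈ Θ <;> simp [hx, singleEstim]
    rw [this]
    exact Finset.measurable_fun_sum _ fun t _ =>
      ((M.reward_measurable.comp ((measurable_pi_apply t).comp measurable_snd)).const_mul _).smul
        (Finset.measurable_fun_sum _ fun l _ => hsc l)

theorem measurable_singleEstim {M : MDP S A T} {Θ : Set (Param d)} (hΘ : IsOpen Θ)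
    {pol : Param d → S → A → ℝ} (hpol : IsPolicyClass M Θ pol) {L₁ L₂ : ℝ}
    (hreg : LogPolicyRegular Θ pol L₁ L₂) (e : EstimatorKind) {θ : Param d} (hθ : θ ∈ Θ) :
    Measurable fun τ => singleEstim M pol τ e θ := by
  have h := (measurable_singleEstim_uncurry hΘ hpol hreg e).comp
    (measurable_prodMk_left (x := θ))
  simpa only [Function.comp_def, Set.indicator_of_mem hθ] using h

theorem differentiableAt_singleEstim (M : MDP S A T) {Θ : Set (Param d)}
    {pol : Param d → S → A → ℝ} {L₁ L₂ : ℝ} (hreg : LogPolicyRegular Θ pol L₁ L₂)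
    (e : EstimatorKind) (τ : Traj S A T) {θ : Param d} (hθ : θ ∈ Θ) :
    DifferentiableAt ℝ (singleEstim M pol τ e) θ := by
  cases e with
  | reinforce =>
    exact (DifferentiableAt.fun_sum fun t _ => hreg.differentiable_score θ hθ _ _).fun_const_smul (ret M τ)
  | gpomdp =>
    exact DifferentiableAt.fun_sum fun t _ =>
      (DifferentiableAt.fun_sum fun l _ => hreg.differentiable_score θ hθ _ _).fun_const_smul _

/-- The absolute value of `rewardBound` makes the bound nonnegative even when `S × A` is empty and
its sign is unconstrained. -/
theorem abs_discounted_reward_le (M : MDP S A T) (τ : Traj S A T) (t : Fin T) :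
    |M.discount ^ (t : ℕ) * M.reward (τ t).1 (τ t).2| ≤ |M.rewardBound| := by
  rw [abs_mul, abs_pow, abs_of_nonneg M.discount_nonneg]
  calc _ ≤ 1 * M.rewardBound := mul_le_mul (pow_le_one₀ M.discount_nonneg M.discount_le_one)
        (M.abs_reward_le _ _) (abs_nonneg _) zero_le_one
    _ ≤ _ := by rw [one_mul]; exact le_abs_self _

theorem abs_ret_le (M : MDP S A T) (τ : Traj S A T) : |ret M τ| ≤ T * |M.rewardBound| := by
  refine (Finset.abs_sum_le_sum_abs _ _).trans
    ((Finset.sum_le_sum fun t _ => abs_discounted_reward_le M τ t).trans ?_)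
  simp

/-- Uniform bound of a combination of the scores of both kinds. -/
theorem norm_estimator_combination_le {E : Type*} [NormedAddCommGroup E] [NormedSpace ℝ E]
    (M : MDP S A T) (τ : Traj S A T) {v : Fin T → E} {c : ℝ} (hc : 0 ≤ c)
    (hv : ∀ t, ‖v t‖ ≤ c) :
    ‖ret M τ • ∑ t, v t‖ ≤ T * |M.rewardBound| * (T * c) ∧
    ‖∑ t : Fin T, (M.discount ^ (t : ℕ) * M.reward (τ t).1 (τ t).2) •
        ∑ l ∈ Finset.univ.filter (fun l : Fin T => l ≤ t), v l‖ ≤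
      T * |M.rewardBound| * (T * c) := by
  have hsum : ∀ I : Finset (Fin T), ‖∑ t ∈ I, v t‖ ≤ T * c := by
    intro I
    refine (norm_sum_le_of_le _ fun t _ => hv t).trans ?_
    rw [Finset.sum_const, nsmul_eq_mul]
    have : (I.card : ℝ) ≤ T := by exact_mod_cast (Finset.card_le_univ I).trans (by simp)
    gcongr
  constructor
  · rw [norm_smul]
    exact mul_le_mul (abs_ret_le M τ) (hsum _) (norm_nonneg _) (by positivity)
  · have h : ∀ t : Fin T, ‖(M.discount ^ (t : ℕ) * M.reward (τ t).1 (τ t).2) •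
        ∑ l ∈ Finset.univ.filter (fun l : Fin T => l ≤ t), v l‖ ≤ |M.rewardBound| * (T * c) := by
      intro t
      rw [norm_smul]
      exact mul_le_mul (abs_discounted_reward_le M τ t) (hsum _) (norm_nonneg _) (abs_nonneg _)
    refine (norm_sum_le_of_le _ fun t _ => h t).trans ?_
    simp [mul_assoc]

theorem exists_estimatorBounds (M : MDP S A T) {Θ : Set (Param d)}
    {pol : Param d → S → A → ℝ} {L₁ L₂ : ℝ} (hreg : LogPolicyRegular Θ pol L₁ L₂)
    (e : EstimatorKind) : ∃ G G₂ : ℝ, EstimatorBounds M Θ pol e G G₂ := by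
  have h1 := hreg.L₁_pos
  have h2 := hreg.L₂_pos
  -- The `+ 1` keeps both constants positive when `T = 0` or the reward bound vanishes.
  refine ⟨T * |M.rewardBound| * (T * L₁) + 1, T * |M.rewardBound| * (T * L₂) + 1,
    by positivity, by positivity, fun θ hθ τ => ?_, fun θ hθ τ => ?_⟩
  · have h := norm_estimator_combination_le M τ h1.le
      (v := fun t => score pol (τ t).1 (τ t).2 θ) fun t => hreg.norm_score_le θ hθ _ _
    cases e with
    | reinforce => exact h.1.trans (by linarith)
    | gpomdp => exact h.2.trans (by linarith)
  · have h := norm_estimator_combination_le M τ h2.le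
      (v := fun t => fderiv ℝ (score pol (τ t).1 (τ t).2) θ) fun t => hreg.norm_hessian_le θ hθ _ _
    have hd : ∀ t : Fin T, HasFDerivAt (score pol (τ t).1 (τ t).2)
        (fderiv ℝ (score pol (τ t).1 (τ t).2) θ) θ := fun t =>
      (hreg.differentiable_score θ hθ _ _).hasFDerivAt
    cases e with
    | reinforce =>
      have hf : HasFDerivAt (singleEstim M pol τ .reinforce)
          (ret M τ • ∑ t, fderiv ℝ (score pol (τ t).1 (τ t).2) θ) θ :=
        (HasFDerivAt.fun_sum fun t _ => hd t).fun_const_smul (ret M τ)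
      rw [hf.fderiv]
      exact h.1.trans (by linarith)
    | gpomdp =>
      have hf : HasFDerivAt (singleEstim M pol τ .gpomdp)
          (∑ t : Fin T, (M.discount ^ (t : ℕ) * M.reward (τ t).1 (τ t).2) •
            ∑ l ∈ Finset.univ.filter (fun l : Fin T => l ≤ t),
              fderiv ℝ (score pol (τ l).1 (τ l).2) θ) θ :=
        HasFDerivAt.fun_sum fun t _ => (HasFDerivAt.fun_sum fun l _ => hd l).fun_const_smul _
      rw [hf.fderiv]
      exact h.2.trans (by linarith)

/-! ### The policy gradient theorem -/

/-- Changing the parameter of the policy at the steps in `I` multiplies the density by the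
exponential of the sum of the log-ratios. -/
theorem pathDensity_mixed_eq {M : MDP S A T} {Θ : Set (Param d)} {pol : Param d → S → A → ℝ}
    {L₁ L₂ : ℝ} (hreg : LogPolicyRegular Θ pol L₁ L₂) (I : Finset (Fin T)) {θ θ₀ : Param d}
    (hθ : θ ∈ Θ) (hθ₀ : θ₀ ∈ Θ) (τ : Traj S A T) :
    pathDensity M (fun t => pol (if t ∈ I then θ else θ₀)) τ =
      trajDensity M pol θ₀ τ * Real.exp (∑ t ∈ I,
        (Real.log (pol θ (τ t).1 (τ t).2) - Real.log (pol θ₀ (τ t).1 (τ t).2))) := by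
  classical
  have h : ∀ t, pol (if t ∈ I then θ else θ₀) (τ t).1 (τ t).2 = pol θ₀ (τ t).1 (τ t).2 *
      if t ∈ I then Real.exp (Real.log (pol θ (τ t).1 (τ t).2) -
        Real.log (pol θ₀ (τ t).1 (τ t).2)) else 1 := by
    intro t
    have h0 := hreg.pol_pos θ₀ hθ₀ (τ t).1 (τ t).2
    split_ifs
    · rw [Real.exp_sub, Real.exp_log h0, Real.exp_log (hreg.pol_pos θ hθ _ _)]
      field_simp
    · rw [mul_one]
  unfold pathDensity trajDensity
  rw [Finset.prod_congr rfl fun t _ => h t, Finset.prod_mul_distrib, Finset.prod_ite_mem,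
    Finset.univ_inter, Real.exp_sum, mul_assoc]

/-- Differentiation under the integral with respect to the parameter used at the steps in `I`. -/
theorem hasGradientAt_integral_mixed {M : MDP S A T} {Θ : Set (Param d)} (hΘ : IsOpen Θ)
    (hconv : Convex ℝ Θ) {pol : Param d → S → A → ℝ} (hpol : IsPolicyClass M Θ pol)
    {L₁ L₂ : ℝ} (hreg : LogPolicyRegular Θ pol L₁ L₂) (I : Finset (Fin T))
    {h : Traj S A T → ℝ} (hh : Measurable h) {c : ℝ} (hc : ∀ τ, |h τ| ≤ c)
    {θ₀ : Param d} (hθ₀ : θ₀ ∈ Θ) :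
    HasGradientAt
      (fun θ => ∫ τ, h τ * pathDensity M (fun t => pol (if t ∈ I then θ else θ₀)) τ ∂(trajRef M))
      (∫ τ, (h τ * trajDensity M pol θ₀ τ) • ∑ t ∈ I, score pol (τ t).1 (τ t).2 θ₀ ∂(trajRef M))
      θ₀ := by
  classical
  let toD := InnerProductSpace.toDual ℝ (Param d)
  let q : Param d → Fin T → S → A → ℝ := fun θ t => pol (if t ∈ I then θ else θ₀)
  let F' : Param d → Traj S A T → StrongDual ℝ (Param d) := fun θ τ =>
    (h τ * pathDensity M (q θ) τ) • ∑ t ∈ I, toD (score pol (τ t).1 (τ t).2 θ)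
  have hL := hreg.L₁_pos
  have hq : ∀ θ ∈ Θ, IsPolicySeq M (q θ) := fun θ hθ =>
    hpol.isPolicySeq fun t => by split_ifs <;> assumption
  have hq0 : pathDensity M (q θ₀) = trajDensity M pol θ₀ := by
    funext τ
    simp only [q, ite_self]
    rfl
  have hsum : ∀ θ ∈ Θ, ∀ τ : Traj S A T, ‖∑ t ∈ I, score pol (τ t).1 (τ t).2 θ‖ ≤ T * L₁ := by
    intro θ hθ τ
    refine (norm_sum_le_of_le _ fun t _ => hreg.norm_score_le θ hθ _ _).trans ?_
    rw [Finset.sum_const, nsmul_eq_mul]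
    have : (I.card : ℝ) ≤ T := by exact_mod_cast (Finset.card_le_univ I).trans (by simp)
    gcongr
  have hF'norm : ∀ θ ∈ Θ, ∀ τ, ‖F' θ τ‖ ≤ c * pathDensity M (q θ) τ * (T * L₁) := by
    intro θ hθ τ
    have hp := pathDensity_nonneg (hq θ hθ) τ
    simp only [F', norm_smul, ← map_sum, LinearIsometryEquiv.norm_map, norm_mul, Real.norm_eq_abs,
      abs_of_nonneg hp]
    have hc0 : 0 ≤ c := (abs_nonneg _).trans (hc τ)
    gcongr
    exacts [hc τ, hsum θ hθ τ]
  have hscore : Measurable fun τ : Traj S A T => ∑ t ∈ I, score pol (τ t).1 (τ t).2 θ₀ := by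
    refine Finset.measurable_fun_sum _ fun t _ => ?_
    have := (measurable_score_uncurry hΘ hpol hreg).comp
      ((measurable_const (a := θ₀)).prodMk (measurable_pi_apply (X := fun _ => S × A) t))
    simpa only [Function.comp_def, Set.indicator_of_mem hθ₀] using this
  have hvmeas : AEStronglyMeasurable (fun τ => (h τ * trajDensity M pol θ₀ τ) •
      ∑ t ∈ I, score pol (τ t).1 (τ t).2 θ₀) (trajRef M) :=
    ((hh.mul (measurable_trajDensity hpol θ₀)).smul hscore).aestronglyMeasurable
  have hF'eq : F' θ₀ = fun τ => toD ((h τ * trajDensity M pol θ₀ τ) •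
      ∑ t ∈ I, score pol (τ t).1 (τ t).2 θ₀) := by
    funext τ
    simp only [F', hq0, ← map_sum]
    exact (LinearIsometryEquiv.map_smulₛₗ toD _ _).symm
  have hF'meas : AEStronglyMeasurable (F' θ₀) (trajRef M) := by
    rw [hF'eq]
    exact toD.continuous.comp_aestronglyMeasurable hvmeas
  -- Within distance `1` of `θ₀` each log-ratio is at most `L₁`, so all mixed densities are
  -- dominated by `exp (T L₁)` times the density at `θ₀`. This is the dominating function for
  -- differentiation under the integral.
  obtain ⟨ε, hε, hball⟩ := Metric.isOpen_iff.1 hΘ θ₀ hθ₀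
  have hbd : ∀ θ ∈ Metric.ball θ₀ (min ε 1), ∀ τ, ‖F' θ τ‖ ≤
      c * (trajDensity M pol θ₀ τ * Real.exp (T * L₁)) * (T * L₁) := by
    intro θ hθ τ
    have hθΘ : θ ∈ Θ := hball (Metric.ball_subset_ball (min_le_left _ _) hθ)
    have hd1 : ‖θ - θ₀‖ ≤ 1 := by
      rw [← dist_eq_norm]
      exact (Metric.mem_ball.1 hθ).le.trans (min_le_right _ _)
    refine (hF'norm θ hθΘ τ).trans ?_
    have hp0 := trajDensity_nonneg hpol hθ₀ τ
    have hc0 : 0 ≤ c := (abs_nonneg _).trans (hc τ)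
    rw [pathDensity_mixed_eq hreg I hθΘ hθ₀ τ]
    gcongr
    calc _ ≤ ∑ t ∈ I, L₁ := Finset.sum_le_sum fun t _ =>
            (le_abs_self _).trans ((hreg.abs_log_sub_le hconv hθ₀ hθΘ _ _).trans (by nlinarith))
      _ ≤ T * L₁ := by
          rw [Finset.sum_const, nsmul_eq_mul]
          have : (I.card : ℝ) ≤ T := by exact_mod_cast (Finset.card_le_univ I).trans (by simp)
          gcongr
  have hdiff : ∀ θ ∈ Metric.ball θ₀ (min ε 1), ∀ τ,
      HasFDerivAt (fun θ => h τ * pathDensity M (q θ) τ) (F' θ τ) θ := by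
    intro θ hθ τ
    have hθΘ : θ ∈ Θ := hball (Metric.ball_subset_ball (min_le_left _ _) hθ)
    have h1 : HasFDerivAt (fun θ => h τ * (trajDensity M pol θ₀ τ * Real.exp (∑ t ∈ I,
        (Real.log (pol θ (τ t).1 (τ t).2) - Real.log (pol θ₀ (τ t).1 (τ t).2)))))
        (h τ • trajDensity M pol θ₀ τ • (Real.exp (∑ t ∈ I,
        (Real.log (pol θ (τ t).1 (τ t).2) - Real.log (pol θ₀ (τ t).1 (τ t).2))) •
          ∑ t ∈ I, toD (score pol (τ t).1 (τ t).2 θ))) θ :=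
      ((HasFDerivAt.fun_sum fun t _ =>
        (hreg.hasFDerivAt_log hθΘ _ _).sub_const _).exp.const_mul _).const_mul _
    have h2 : F' θ τ = h τ • trajDensity M pol θ₀ τ • (Real.exp (∑ t ∈ I,
        (Real.log (pol θ (τ t).1 (τ t).2) - Real.log (pol θ₀ (τ t).1 (τ t).2))) •
          ∑ t ∈ I, toD (score pol (τ t).1 (τ t).2 θ)) := by
      simp only [F', q, pathDensity_mixed_eq hreg I hθΘ hθ₀ τ, smul_smul]
    rw [h2]
    refine h1.congr_of_eventuallyEq ?_
    filter_upwards [hΘ.mem_nhds hθΘ] with θ' hθ'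
    simp only [q, pathDensity_mixed_eq hreg I hθ' hθ₀ τ]
  have hbint : Integrable (fun τ => c * (trajDensity M pol θ₀ τ * Real.exp (T * L₁)) * (T * L₁))
      (trajRef M) :=
    (((integrable_trajDensity hpol hθ₀).mul_const _).const_mul _).mul_const _
  have hmain := hasFDerivAt_integral_of_dominated_of_fderiv_le (𝕜 := ℝ) (μ := trajRef M)
    (F := fun θ τ => h τ * pathDensity M (q θ) τ) (F' := F') (x₀ := θ₀)
    (s := Metric.ball θ₀ (min ε 1))
    (Metric.ball_mem_nhds _ (lt_min hε one_pos))
    (by filter_upwards [hΘ.mem_nhds hθ₀] with θ hθ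
        exact (hh.mul (measurable_pathDensity (hq θ hθ))).aestronglyMeasurable)
    (integrable_mul_pathDensity (hq θ₀ hθ₀) hh hc) hF'meas (ae_of_all _ fun τ θ hθ => hbd θ hθ τ)
    hbint (ae_of_all _ fun τ θ hθ => hdiff θ hθ τ)
  rw [hasGradientAt_iff_hasFDerivAt]
  have hF'int : Integrable (F' θ₀) (trajRef M) := hbint.mono' hF'meas (ae_of_all _ fun τ =>
    hbd θ₀ (Metric.mem_ball_self (lt_min hε one_pos)) τ)
  have hvint : Integrable (fun τ => (h τ * trajDensity M pol θ₀ τ) •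
      ∑ t ∈ I, score pol (τ t).1 (τ t).2 θ₀) (trajRef M) := by
    refine hF'int.norm.mono' hvmeas (ae_of_all _ fun τ => ?_)
    rw [hF'eq]
    exact (LinearIsometryEquiv.norm_map toD _).ge
  have hcomm : toD (∫ τ, (h τ * trajDensity M pol θ₀ τ) •
      ∑ t ∈ I, score pol (τ t).1 (τ t).2 θ₀ ∂(trajRef M)) = ∫ τ, F' θ₀ τ ∂(trajRef M) := by
    ext v
    rw [ContinuousLinearMap.integral_apply hF'int, InnerProductSpace.toDual_apply_apply,
      real_inner_comm, ← integral_inner hvint, hF'eq]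
    refine integral_congr_ae (ae_of_all _ fun τ => ?_)
    simp only [toD, InnerProductSpace.toDual_apply_apply]
    rw [real_inner_comm]
  exact hcomm ▸ hmain

/-- The expectation under `p_θ` of the single-trajectory estimator. -/
def meanEstim (M : MDP S A T) (pol : Param d → S → A → ℝ) (e : EstimatorKind) (θ : Param d) :
    Param d :=
  ∫ τ, trajDensity M pol θ τ • singleEstim M pol τ e θ ∂(trajRef M)

theorem J_eq_integral {M : MDP S A T} {Θ : Set (Param d)} {pol : Param d → S → A → ℝ}
    (hpol : IsPolicyClass M Θ pol) {θ : Param d} (hθ : θ ∈ Θ) :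
    J M pol θ = ∫ τ, ret M τ * trajDensity M pol θ τ ∂(trajRef M) := by
  rw [J, trajLaw, integral_withDensity_eq_integral_toReal_smul
    (measurable_trajDensity hpol θ).ennreal_ofReal (ae_of_all _ fun _ => ENNReal.ofReal_lt_top)]
  refine integral_congr_ae (ae_of_all _ fun τ => ?_)
  simp only [ENNReal.toReal_ofReal (trajDensity_nonneg hpol hθ τ), smul_eq_mul, mul_comm]

theorem integrable_smul_trajDensity {E : Type*} [NormedAddCommGroup E] [NormedSpace ℝ E]
    [MeasurableSpace E] [BorelSpace E] [SecondCountableTopology E] {M : MDP S A T}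
    {Θ : Set (Param d)} {pol : Param d → S → A → ℝ} (hpol : IsPolicyClass M Θ pol) {θ : Param d}
    (hθ : θ ∈ Θ) {f : Traj S A T → E} (hf : Measurable f) {c : ℝ} (hc : ∀ τ, ‖f τ‖ ≤ c) :
    Integrable (fun τ => trajDensity M pol θ τ • f τ) (trajRef M) := by
  refine ((integrable_trajDensity hpol hθ).const_mul c).mono'
    ((measurable_trajDensity hpol θ).smul hf).aestronglyMeasurable (ae_of_all _ fun τ => ?_)
  have hp := trajDensity_nonneg hpol hθ τ
  rw [norm_smul, Real.norm_of_nonneg hp, mul_comm]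
  gcongr
  exact hc τ

/-- Both estimators are unbiased for the gradient of the expected return. -/
theorem hasGradientAt_J {M : MDP S A T} {Θ : Set (Param d)} (hΘ : IsOpen Θ)
    (hconv : Convex ℝ Θ) {pol : Param d → S → A → ℝ} (hpol : IsPolicyClass M Θ pol)
    {L₁ L₂ : ℝ} (hreg : LogPolicyRegular Θ pol L₁ L₂) (e : EstimatorKind)
    {θ₀ : Param d} (hθ₀ : θ₀ ∈ Θ) : HasGradientAt (J M pol) (meanEstim M pol e θ₀) θ₀ := by
  cases e with
  | reinforce =>
    have h := hasGradientAt_integral_mixed hΘ hconv hpol hreg Finset.univ (measurable_ret M)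
      (abs_ret_le M) hθ₀
    have hval : (∫ τ, (ret M τ * trajDensity M pol θ₀ τ) •
        ∑ t, score pol (τ t).1 (τ t).2 θ₀ ∂(trajRef M)) = meanEstim M pol .reinforce θ₀ := by
      refine integral_congr_ae (ae_of_all _ fun τ => ?_)
      simp only [singleEstim, smul_smul, mul_comm]
    rw [hval] at h
    refine h.congr_of_eventuallyEq ?_
    filter_upwards [hΘ.mem_nhds hθ₀] with θ hθ
    rw [J_eq_integral hpol hθ]
    simp only [Finset.mem_univ, if_true]
    rfl
  | gpomdp =>
    -- Causality: the reward of step `t` does not see later policies, so for this reward only the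
    -- policies up to step `t` vary and the others stay at `θ₀`. Differentiation then produces
    -- exactly the scores with `l ≤ t`.
    let r : Fin T → Traj S A T → ℝ := fun t τ =>
      M.discount ^ (t : ℕ) * M.reward (τ t).1 (τ t).2
    let I : Fin T → Finset (Fin T) := fun t => Finset.univ.filter fun l : Fin T => l ≤ t
    have hr : ∀ t, Measurable (r t) := fun t =>
      (M.reward_measurable.comp (measurable_pi_apply t)).const_mul _
    have hrb : ∀ t τ, |r t τ| ≤ |M.rewardBound| := fun t τ => abs_discounted_reward_le M τ t
    have h : HasFDerivAt (fun θ => ∑ t, ∫ τ, r t τ *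
        pathDensity M (fun l => pol (if l ∈ I t then θ else θ₀)) τ ∂(trajRef M))
        (∑ t, InnerProductSpace.toDual ℝ (Param d) (∫ τ, (r t τ * trajDensity M pol θ₀ τ) •
          ∑ l ∈ I t, score pol (τ l).1 (τ l).2 θ₀ ∂(trajRef M))) θ₀ :=
      HasFDerivAt.fun_sum fun t _ => hasGradientAt_iff_hasFDerivAt.1
        (hasGradientAt_integral_mixed hΘ hconv hpol hreg (I t) (hr t) (hrb t) hθ₀)
    rw [← map_sum, ← hasGradientAt_iff_hasFDerivAt] at h
    have hscb : ∀ t, ∀ τ : Traj S A T,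
        ‖r t τ • ∑ l ∈ I t, score pol (τ l).1 (τ l).2 θ₀‖ ≤
          |M.rewardBound| * ∑ l ∈ I t, L₁ := by
      intro t τ
      rw [norm_smul]
      exact mul_le_mul (hrb t τ) (norm_sum_le_of_le _ fun l _ => hreg.norm_score_le θ₀ hθ₀ _ _)
        (norm_nonneg _) (abs_nonneg _)
    have hscm : ∀ t, Measurable fun τ : Traj S A T =>
        r t τ • ∑ l ∈ I t, score pol (τ l).1 (τ l).2 θ₀ := by
      intro t
      refine (hr t).smul (Finset.measurable_fun_sum _ fun l _ => ?_)
      have := (measurable_score_uncurry hΘ hpol hreg).comp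
        ((measurable_const (a := θ₀)).prodMk (measurable_pi_apply (X := fun _ => S × A) l))
      simpa only [Function.comp_def, Set.indicator_of_mem hθ₀] using this
    have hval : ∑ t, (∫ τ, (r t τ * trajDensity M pol θ₀ τ) •
        ∑ l ∈ I t, score pol (τ l).1 (τ l).2 θ₀ ∂(trajRef M)) = meanEstim M pol .gpomdp θ₀ := by
      have h1 : ∀ t, (∫ τ, (r t τ * trajDensity M pol θ₀ τ) •
          ∑ l ∈ I t, score pol (τ l).1 (τ l).2 θ₀ ∂(trajRef M)) =
          ∫ τ, trajDensity M pol θ₀ τ • r t τ • ∑ l ∈ I t, score pol (τ l).1 (τ l).2 θ₀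
            ∂(trajRef M) := fun t => by
        refine integral_congr_ae (ae_of_all _ fun τ => ?_)
        simp only [smul_smul, mul_comm]
      rw [Finset.sum_congr rfl fun t _ => h1 t, ← integral_finsetSum _ fun t _ =>
        integrable_smul_trajDensity hpol hθ₀ (hscm t) (hscb t)]
      refine integral_congr_ae (ae_of_all _ fun τ => ?_)
      simp only [singleEstim, Finset.smul_sum, r, I]
    rw [hval] at h
    refine h.congr_of_eventuallyEq ?_
    filter_upwards [hΘ.mem_nhds hθ₀] with θ hθ
    have hq : IsPolicySeq M fun _ : Fin T => pol θ :=
      hpol.isPolicySeq (θ := fun _ => θ) fun _ => hθ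
    -- The frozen policies may be replaced by `pol θ` without changing the integral, since `r t` is
    -- a function of the first `t + 1` steps.
    have h2 : ∀ t, ∫ τ, r t τ *
        pathDensity M (fun l => pol (if l ∈ I t then θ else θ₀)) τ ∂(trajRef M) =
        ∫ τ, r t τ * pathDensity M (fun _ => pol θ) τ ∂(trajRef M) := by
      intro t
      refine integral_pathDensity_congr (hpol.isPolicySeq fun l => by split_ifs <;> assumption)
        hq (hr t) (hrb t) (t + 1) (fun l hl τ x => ?_) fun l hl => ?_
      · have : t ≠ l := fun h => by subst h; omega
        simp only [r, Function.update_of_ne this]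
      · have : l ≤ t := Fin.le_def.2 (by omega)
        simp [I, this]
    simp only [h2]
    rw [J_eq_integral hpol hθ, ← integral_finsetSum _ fun t _ =>
      integrable_mul_pathDensity hq (hr t) (hrb t)]
    refine integral_congr_ae (ae_of_all _ fun τ => ?_)
    simp only [ret, Finset.sum_mul, r]
    rfl

/-! ### Lipschitz dependence on the parameter. -/

theorem norm_singleEstim_sub_le {M : MDP S A T} {Θ : Set (Param d)}
    (hconv : Convex ℝ Θ) {pol : Param d → S → A → ℝ}
    {L₁ L₂ : ℝ} (hreg : LogPolicyRegular Θ pol L₁ L₂) {e : EstimatorKind} {G G₂ : ℝ}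
    (hG : EstimatorBounds M Θ pol e G G₂) {θ θ' : Param d} (hθ : θ ∈ Θ) (hθ' : θ' ∈ Θ)
    (τ : Traj S A T) :
    ‖singleEstim M pol τ e θ' - singleEstim M pol τ e θ‖ ≤ G₂ * ‖θ' - θ‖ :=
  hconv.norm_image_sub_le_of_norm_fderiv_le (𝕜 := ℝ)
    (fun _ hx => differentiableAt_singleEstim M hreg e τ hx)
    (fun x hx => hG.norm_fderiv_le x hx τ) hθ hθ'

theorem integrable_trajDensity_smul_singleEstim {M : MDP S A T} {Θ : Set (Param d)}
    (hΘ : IsOpen Θ) {pol : Param d → S → A → ℝ} (hpol : IsPolicyClass M Θ pol)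
    {L₁ L₂ : ℝ} (hreg : LogPolicyRegular Θ pol L₁ L₂) {e : EstimatorKind} {G G₂ : ℝ}
    (hG : EstimatorBounds M Θ pol e G G₂) {θ θ' : Param d} (hθ : θ ∈ Θ) (hθ' : θ' ∈ Θ) :
    Integrable (fun τ => trajDensity M pol θ τ • singleEstim M pol τ e θ') (trajRef M) :=
  integrable_smul_trajDensity hpol hθ (measurable_singleEstim hΘ hpol hreg e hθ')
    (hG.norm_le θ' hθ')

/-- The expectation of a bounded function is Lipschitz in the parameter of the policy. -/
theorem abs_integral_trajDensity_sub_le {M : MDP S A T} {Θ : Set (Param d)} (hΘ : IsOpen Θ)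
    (hconv : Convex ℝ Θ) {pol : Param d → S → A → ℝ} (hpol : IsPolicyClass M Θ pol)
    {L₁ L₂ : ℝ} (hreg : LogPolicyRegular Θ pol L₁ L₂) {h : Traj S A T → ℝ} (hh : Measurable h)
    {c : ℝ} (hc : ∀ τ, |h τ| ≤ c) (hc0 : 0 ≤ c) {θ θ' : Param d} (hθ : θ ∈ Θ) (hθ' : θ' ∈ Θ) :
    |∫ τ, h τ * trajDensity M pol θ' τ ∂(trajRef M) - ∫ τ, h τ * trajDensity M pol θ τ ∂(trajRef M)|
      ≤ c * (T * L₁) * ‖θ' - θ‖ := by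
  let v : Param d → Param d := fun x => ∫ τ, (h τ * trajDensity M pol x τ) •
    ∑ t : Fin T, score pol (τ t).1 (τ t).2 x ∂(trajRef M)
  refine Convex.norm_image_sub_le_of_norm_hasFDerivWithin_le
    (f := fun x => ∫ τ, h τ * trajDensity M pol x τ ∂(trajRef M))
    (f' := fun x => InnerProductSpace.toDual ℝ (Param d) (v x)) (fun x hx => ?_)
    (fun x hx => ?_) hconv hθ hθ'
  · have hg := hasGradientAt_integral_mixed hΘ hconv hpol hreg Finset.univ hh hc hx
    simp only [Finset.mem_univ, if_true] at hg
    exact (hasGradientAt_iff_hasFDerivAt.1 hg).hasFDerivWithinAt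
  · rw [LinearIsometryEquiv.norm_map]
    refine (norm_integral_le_of_norm_le
      ((integrable_trajDensity hpol hx).const_mul (c * (T * L₁))) (ae_of_all _ fun τ => ?_)).trans
      (by rw [integral_const_mul, integral_trajDensity hpol hx, mul_one])
    have hp := trajDensity_nonneg hpol hx τ
    have hs : ‖∑ t : Fin T, score pol (τ t).1 (τ t).2 x‖ ≤ T * L₁ :=
      (norm_sum_le_of_le _ fun t _ => hreg.norm_score_le x hx _ _).trans (by simp)
    rw [norm_smul, norm_mul, Real.norm_eq_abs, Real.norm_of_nonneg hp]
    calc _ ≤ c * trajDensity M pol x τ * (T * L₁) := by gcongr; exact hc τ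
      _ = _ := by ring

/-- Density and integrand both move with the parameter. Moving the integrand alone costs `G₂`;
moving the density alone costs `G T L₁`, as the total score is at most `T L₁`. -/
theorem norm_meanEstim_sub_le {M : MDP S A T} {Θ : Set (Param d)} (hΘ : IsOpen Θ)
    (hconv : Convex ℝ Θ) {pol : Param d → S → A → ℝ} (hpol : IsPolicyClass M Θ pol)
    {L₁ L₂ : ℝ} (hreg : LogPolicyRegular Θ pol L₁ L₂) {e : EstimatorKind} {G G₂ : ℝ}
    (hG : EstimatorBounds M Θ pol e G G₂) {θ θ' : Param d} (hθ : θ ∈ Θ) (hθ' : θ' ∈ Θ) :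
    ‖meanEstim M pol e θ' - meanEstim M pol e θ‖ ≤ (G * T * L₁ + G₂) * ‖θ' - θ‖ := by
  have hint := fun {x y : Param d} (hx : x ∈ Θ) (hy : y ∈ Θ) =>
    integrable_trajDensity_smul_singleEstim hΘ hpol hreg hG hx hy
  let m : Param d := ∫ τ, trajDensity M pol θ' τ • singleEstim M pol τ e θ ∂(trajRef M)
  have h1 : ‖meanEstim M pol e θ' - m‖ ≤ G₂ * ‖θ' - θ‖ := by
    simp only [meanEstim, m]
    rw [← integral_sub (hint hθ' hθ') (hint hθ' hθ)]
    refine (norm_integral_le_of_norm_le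
      ((integrable_trajDensity hpol hθ').const_mul (G₂ * ‖θ' - θ‖))
      (ae_of_all _ fun τ => ?_)).trans
      (by rw [integral_const_mul, integral_trajDensity hpol hθ', mul_one])
    have hp := trajDensity_nonneg hpol hθ' τ
    rw [← smul_sub, norm_smul, Real.norm_of_nonneg hp, mul_comm]
    gcongr
    exact norm_singleEstim_sub_le hconv hreg hG hθ hθ' τ
  have h2 : ‖m - meanEstim M pol e θ‖ ≤ G * T * L₁ * ‖θ' - θ‖ := by
    have key : ∀ u : Param d, inner ℝ u (m - meanEstim M pol e θ) ≤
        ‖u‖ * (G * T * L₁ * ‖θ' - θ‖) := by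
      intro u
      rw [inner_sub_right]
      simp only [m, meanEstim]
      rw [← integral_inner (hint hθ' hθ), ← integral_inner (hint hθ hθ)]
      have hb : ∀ τ, |inner ℝ u (singleEstim M pol τ e θ)| ≤ ‖u‖ * G := fun τ =>
        (abs_real_inner_le_norm _ _).trans
          (mul_le_mul_of_nonneg_left (hG.norm_le θ hθ τ) (norm_nonneg _))
      have := abs_integral_trajDensity_sub_le hΘ hconv hpol hreg
        (measurable_const.inner (measurable_singleEstim hΘ hpol hreg e hθ)) hb
        (mul_nonneg (norm_nonneg _) hG.G_pos.le) hθ hθ'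
      simp only [real_inner_smul_right, mul_comm (trajDensity M pol _ _)]
      refine (le_abs_self _).trans (this.trans (le_of_eq ?_))
      ring
    -- The scalar bound, tested in the direction of the difference itself, gives its norm without
    -- loss.
    have h3 := key (m - meanEstim M pol e θ)
    rw [real_inner_self_eq_norm_sq, sq] at h3
    rcases (norm_nonneg (m - meanEstim M pol e θ)).eq_or_lt with h0 | h0
    · rw [← h0]
      have := hG.G_pos
      have := hreg.L₁_pos
      positivity
    · exact le_of_mul_le_mul_left h3 h0
  calc _ ≤ ‖meanEstim M pol e θ' - m‖ + ‖m - meanEstim M pol e θ‖ :=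
        norm_sub_le_norm_sub_add_norm_sub _ _ _
    _ ≤ _ := by linarith

/-! ### Bias and exponential moments of the power mean weights -/

/-- The power mean importance weight of a sample with density `a` for a target density `b`. -/
def powerWeight (l a b : ℝ) : ℝ := 1 / ((1 - l) * (a / b) + l)

theorem le_powerWeight_denom {l a b : ℝ} (hl : l ≤ 1) (ha : 0 ≤ a) (hb : 0 ≤ b) :
    l ≤ (1 - l) * (a / b) + l := by
  have : 0 ≤ (1 - l) * (a / b) := mul_nonneg (by linarith) (div_nonneg ha hb)
  linarith

theorem powerWeight_nonneg {l a b : ℝ} (hl0 : 0 < l) (hl : l ≤ 1) (ha : 0 ≤ a) (hb : 0 ≤ b) :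
    0 ≤ powerWeight l a b :=
  one_div_nonneg.2 (hl0.le.trans (le_powerWeight_denom hl ha hb))

theorem powerWeight_le {l a b : ℝ} (hl0 : 0 < l) (hl : l ≤ 1) (ha : 0 ≤ a) (hb : 0 ≤ b) :
    powerWeight l a b ≤ 1 / l :=
  one_div_le_one_div_of_le hl0 (le_powerWeight_denom hl ha hb)

theorem powerWeight_eq {l a b : ℝ} (hb : 0 < b) :
    powerWeight l a b = b / ((1 - l) * a + l * b) := by
  unfold powerWeight
  rw [show (1 - l) * (a / b) + l = ((1 - l) * a + l * b) / b by field_simp, one_div_div]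

/-- The weighted arithmetic mean dominates the weighted harmonic mean, without denominators. -/
theorem mul_le_mean_mul_mean {l a b : ℝ} (hl0 : 0 ≤ l) (hl : l ≤ 1) :
    a * b ≤ ((1 - l) * a + l * b) * ((1 - l) * b + l * a) := by
  nlinarith [mul_nonneg (mul_nonneg hl0 (sub_nonneg.2 hl)) (sq_nonneg (a - b))]

/-- With `m = (1-l)a + lb` and `m' = (1-l)b + la`, the mean inequality gives `b/m ≤ m'/a`, so the
left side is at most `m'²/a`; convexity of the square finishes. The right side integrates to at most
`(1-l)D + l ≤ D`. -/
theorem powerWeight_sq_mul_le {l a b : ℝ} (hl0 : 0 < l) (hl : l ≤ 1)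
    (hab : (0 < a ∧ 0 < b) ∨ (a = 0 ∧ b = 0)) :
    powerWeight l a b ^ 2 * a ≤ (1 - l) * (b ^ 2 / a) + l * a := by
  rcases hab with ⟨ha, hb⟩ | ⟨rfl, rfl⟩
  · have hm : 0 < (1 - l) * a + l * b := by nlinarith [mul_pos hl0 hb]
    have hm' : 0 ≤ (1 - l) * b + l * a := by nlinarith [mul_pos hl0 ha]
    have h1 := mul_le_mean_mul_mean (a := a) (b := b) hl0.le hl
    have h2 : (a * b) ^ 2 ≤
        ((1 - l) * a + l * b) ^ 2 * ((1 - l) * b + l * a) ^ 2 := by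
      rw [← mul_pow]
      exact pow_le_pow_left₀ (by positivity) h1 2
    have h3 : ((1 - l) * b + l * a) ^ 2 ≤ (1 - l) * b ^ 2 + l * a ^ 2 := by
      nlinarith [mul_nonneg (mul_nonneg hl0.le (sub_nonneg.2 hl)) (sq_nonneg (a - b))]
    rw [powerWeight_eq hb, div_pow, div_mul_eq_mul_div, div_le_iff₀ (by positivity)]
    have h4 : (1 - l) * (b ^ 2 / a) + l * a = ((1 - l) * b ^ 2 + l * a ^ 2) / a := by
      field_simp
    rw [h4, div_mul_eq_mul_div, le_div_iff₀ ha]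
    calc b ^ 2 * a * a = (a * b) ^ 2 := by ring
      _ ≤ ((1 - l) * a + l * b) ^ 2 * ((1 - l) * b ^ 2 + l * a ^ 2) :=
        h2.trans (by gcongr)
      _ = _ := by ring
  · simp

/-- The difference equals `l (b/m)(a - b)` with `m = (1-l)a + lb`, so the bias carries a factor `l`;
what remains is bounded by `b/m ≤ ((1-l)b + la)/a` and `|a - b| ≤ a + b`. -/
theorem abs_powerWeight_mul_sub_le {l a b : ℝ} (hl0 : 0 < l) (hl : l ≤ 1)
    (hab : (0 < a ∧ 0 < b) ∨ (a = 0 ∧ b = 0)) :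
    |powerWeight l a b * a - b| ≤
      l * ((1 - l) * (b ^ 2 / a) + l * b + ((1 - l) * b + l * a)) := by
  rcases hab with ⟨ha, hb⟩ | ⟨rfl, rfl⟩
  · have hm : 0 < (1 - l) * a + l * b := by nlinarith [mul_pos hl0 hb]
    have h1 := mul_le_mean_mul_mean (a := a) (b := b) hl0.le hl
    have h2 : powerWeight l a b * a - b = l * (b / ((1 - l) * a + l * b) * (a - b)) := by
      have hdiv := div_mul_cancel₀ b hm.ne'
      rw [powerWeight_eq hb]
      linear_combination hdiv
    have h3 : |a - b| ≤ a + b := abs_le.2 ⟨by linarith, by linarith⟩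
    have h4 : b / ((1 - l) * a + l * b) ≤ ((1 - l) * b + l * a) / a := by
      rw [div_le_div_iff₀ hm ha]
      linarith
    rw [h2, abs_mul, abs_of_pos hl0, abs_mul, abs_of_pos (div_pos hb hm)]
    refine mul_le_mul_of_nonneg_left ?_ hl0.le
    calc _ ≤ ((1 - l) * b + l * a) / a * (a + b) :=
          mul_le_mul h4 h3 (abs_nonneg _) ((div_pos hb hm).le.trans h4)
      _ = _ := by field_simp; ring
  · simp

/-- Policies are strictly positive, so a density vanishes only through the initial and transition
factors, which all parameters share. Division by zero therefore occurs only where both densities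
vanish. -/
theorem trajDensity_pos_or_eq_zero {M : MDP S A T} {Θ : Set (Param d)}
    {pol : Param d → S → A → ℝ} {L₁ L₂ : ℝ} (hreg : LogPolicyRegular Θ pol L₁ L₂)
    {θ θ' : Param d} (hθ : θ ∈ Θ) (hθ' : θ' ∈ Θ) (τ : Traj S A T) :
    (0 < trajDensity M pol θ τ ∧ 0 < trajDensity M pol θ' τ) ∨
      (trajDensity M pol θ τ = 0 ∧ trajDensity M pol θ' τ = 0) := by
  unfold trajDensity
  have hpos : ∀ {x}, x ∈ Θ → 0 < ∏ t : Fin T, pol x (τ t).1 (τ t).2 := fun hx =>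
    Finset.prod_pos fun t _ => hreg.pol_pos _ hx _ _
  rcases (Finset.prod_nonneg fun t (_ : t ∈ Finset.univ) =>
    stateDensity_nonneg M τ t).eq_or_lt with h | h
  · right
    simp [← h]
  · exact Or.inl ⟨mul_pos h (hpos hθ), mul_pos h (hpos hθ')⟩

/-- The truncated subtraction in `chiSq` is harmless for an upper bound: the `1` moves to the other
side. -/
theorem BoundedChiSq.lintegral_le {M : MDP S A T} {Θ : Set (Param d)}
    {pol : Param d → S → A → ℝ} {D : ℝ} (hD : BoundedChiSq M Θ pol D) {θ θ' : Param d}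
    (hθ : θ ∈ Θ) (hθ' : θ' ∈ Θ) :
    ∫⁻ τ, ENNReal.ofReal (trajDensity M pol θ τ ^ 2 / trajDensity M pol θ' τ) ∂(trajRef M) ≤
      ENNReal.ofReal D := by
  have h := hD.chiSq_le θ hθ θ' hθ'
  rw [chiSq, tsub_le_iff_right, ← ENNReal.ofReal_one,
    ← ENNReal.ofReal_add (by linarith [hD.one_le]) zero_le_one] at h
  simpa using h

theorem BoundedChiSq.integrable {M : MDP S A T} {Θ : Set (Param d)}
    {pol : Param d → S → A → ℝ} (hpol : IsPolicyClass M Θ pol) {D : ℝ}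
    (hD : BoundedChiSq M Θ pol D) {θ θ' : Param d} (hθ : θ ∈ Θ) (hθ' : θ' ∈ Θ) :
    Integrable (fun τ => trajDensity M pol θ τ ^ 2 / trajDensity M pol θ' τ) (trajRef M) := by
  refine ⟨(((measurable_trajDensity hpol θ).pow_const 2).div
    (measurable_trajDensity hpol θ')).aestronglyMeasurable, ?_⟩
  rw [hasFiniteIntegral_iff_ofReal (ae_of_all _ fun τ =>
    div_nonneg (sq_nonneg _) (trajDensity_nonneg hpol hθ' τ))]
  exact (hD.lintegral_le hθ hθ').trans_lt ENNReal.ofReal_lt_top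

theorem BoundedChiSq.integral_le {M : MDP S A T} {Θ : Set (Param d)}
    {pol : Param d → S → A → ℝ} (hpol : IsPolicyClass M Θ pol) {D : ℝ}
    (hD : BoundedChiSq M Θ pol D) {θ θ' : Param d} (hθ : θ ∈ Θ) (hθ' : θ' ∈ Θ) :
    ∫ τ, trajDensity M pol θ τ ^ 2 / trajDensity M pol θ' τ ∂(trajRef M) ≤ D := by
  rw [integral_eq_lintegral_of_nonneg_ae (ae_of_all _ fun τ =>
    div_nonneg (sq_nonneg _) (trajDensity_nonneg hpol hθ' τ))
    (BoundedChiSq.integrable hpol hD hθ hθ').aestronglyMeasurable]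
  exact ENNReal.toReal_le_of_le_ofReal (by linarith [hD.one_le]) (hD.lintegral_le hθ hθ')

/-! ### Moments of the weighted estimator. -/

/-- The weighted estimator in direction `u` for the target `y`, on a trajectory of parameter `t`. -/
def weightedEstim (M : MDP S A T) (pol : Param d → S → A → ℝ) (e : EstimatorKind) (l : ℝ)
    (u y t : Param d) (τ : Traj S A T) : ℝ :=
  powerWeight l (trajDensity M pol t τ) (trajDensity M pol y τ) *
    inner ℝ u (singleEstim M pol τ e y)

theorem abs_inner_singleEstim_le {M : MDP S A T} {Θ : Set (Param d)}
    {pol : Param d → S → A → ℝ} {e : EstimatorKind} {G G₂ : ℝ}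
    (hG : EstimatorBounds M Θ pol e G G₂) {u y : Param d} (hu : ‖u‖ ≤ 1) (hy : y ∈ Θ)
    (τ : Traj S A T) : |inner ℝ u (singleEstim M pol τ e y)| ≤ G :=
  (abs_real_inner_le_norm _ _).trans
    ((mul_le_mul hu (hG.norm_le y hy τ) (norm_nonneg _) zero_le_one).trans (one_mul G).le)

theorem abs_weightedEstim_le {M : MDP S A T} {Θ : Set (Param d)}
    {pol : Param d → S → A → ℝ} (hpol : IsPolicyClass M Θ pol) {e : EstimatorKind} {G G₂ : ℝ}
    (hG : EstimatorBounds M Θ pol e G G₂) {l : ℝ} (hl0 : 0 < l) (hl : l ≤ 1) {u y t : Param d}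
    (hu : ‖u‖ ≤ 1) (hy : y ∈ Θ) (ht : t ∈ Θ) (τ : Traj S A T) :
    |weightedEstim M pol e l u y t τ| ≤ G / l := by
  have hp := trajDensity_nonneg hpol ht τ
  have hp' := trajDensity_nonneg hpol hy τ
  rw [weightedEstim, abs_mul, abs_of_nonneg (powerWeight_nonneg hl0 hl hp hp')]
  calc _ ≤ 1 / l * G := mul_le_mul (powerWeight_le hl0 hl hp hp')
        (abs_inner_singleEstim_le hG hu hy τ) (abs_nonneg _) (by positivity)
    _ = G / l := by ring

theorem measurable_weightedEstim {M : MDP S A T} {Θ : Set (Param d)} (hΘ : IsOpen Θ)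
    {pol : Param d → S → A → ℝ} (hpol : IsPolicyClass M Θ pol) {L₁ L₂ : ℝ}
    (hreg : LogPolicyRegular Θ pol L₁ L₂) (e : EstimatorKind) (l : ℝ) {u y t : Param d}
    (hy : y ∈ Θ) : Measurable (weightedEstim M pol e l u y t) := by
  refine Measurable.mul ?_ (measurable_const.inner (measurable_singleEstim hΘ hpol hreg e hy))
  exact measurable_const.div ((((measurable_trajDensity hpol t).div
    (measurable_trajDensity hpol y)).const_mul _).add_const _)

theorem integral_weightedEstim_sq_le {M : MDP S A T} {Θ : Set (Param d)}
    {pol : Param d → S → A → ℝ} (hpol : IsPolicyClass M Θ pol)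
    {L₁ L₂ : ℝ} (hreg : LogPolicyRegular Θ pol L₁ L₂) {D : ℝ} (hD : BoundedChiSq M Θ pol D)
    {e : EstimatorKind} {G G₂ : ℝ} (hG : EstimatorBounds M Θ pol e G G₂) {l : ℝ} (hl0 : 0 < l)
    (hl : l ≤ 1) {u y t : Param d} (hu : ‖u‖ ≤ 1) (hy : y ∈ Θ) (ht : t ∈ Θ) :
    ∫ τ, weightedEstim M pol e l u y t τ ^ 2 * trajDensity M pol t τ ∂(trajRef M) ≤ G ^ 2 * D := by
  have hint := (((BoundedChiSq.integrable hpol hD hy ht).const_mul (1 - l)).add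
    ((integrable_trajDensity hpol ht).const_mul l)).const_mul (G ^ 2)
  have hval := BoundedChiSq.integral_le hpol hD hy ht
  calc _ ≤ ∫ τ, G ^ 2 * ((1 - l) * (trajDensity M pol y τ ^ 2 / trajDensity M pol t τ) +
        l * trajDensity M pol t τ) ∂(trajRef M) := by
        refine integral_mono_of_nonneg (ae_of_all _ fun τ =>
          mul_nonneg (sq_nonneg _) (trajDensity_nonneg hpol ht τ)) hint (ae_of_all _ fun τ => ?_)
        have h1 := powerWeight_sq_mul_le hl0 hl
          (trajDensity_pos_or_eq_zero (M := M) hreg ht hy τ)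
        have h2 := abs_inner_singleEstim_le hG hu hy τ
        have h3 : inner ℝ u (singleEstim M pol τ e y) ^ 2 ≤ G ^ 2 := sq_le_sq' (abs_le.1 h2).1
          (abs_le.1 h2).2
        simp only [weightedEstim]
        calc _ = inner ℝ u (singleEstim M pol τ e y) ^ 2 *
              (powerWeight l (trajDensity M pol t τ) (trajDensity M pol y τ) ^ 2 *
                trajDensity M pol t τ) := by ring
          _ ≤ _ := mul_le_mul h3 h1
              (mul_nonneg (sq_nonneg _) (trajDensity_nonneg hpol ht τ)) (sq_nonneg _)
    _ ≤ G ^ 2 * D := by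
        rw [integral_const_mul, integral_add
          ((BoundedChiSq.integrable hpol hD hy ht).const_mul _)
          ((integrable_trajDensity hpol ht).const_mul _), integral_const_mul, integral_const_mul,
          integral_trajDensity hpol ht]
        refine mul_le_mul_of_nonneg_left ?_ (sq_nonneg G)
        nlinarith [hD.one_le]

/-- The pointwise bound integrates to `G l` times at most `(1-l)D + l + 1`, and this factor is at
most `2D` because `D ≥ 1`. -/
theorem integral_weightedEstim_le {M : MDP S A T} {Θ : Set (Param d)} (hΘ : IsOpen Θ)
    {pol : Param d → S → A → ℝ} (hpol : IsPolicyClass M Θ pol)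
    {L₁ L₂ : ℝ} (hreg : LogPolicyRegular Θ pol L₁ L₂) {D : ℝ} (hD : BoundedChiSq M Θ pol D)
    {e : EstimatorKind} {G G₂ : ℝ} (hG : EstimatorBounds M Θ pol e G G₂) {l : ℝ} (hl0 : 0 < l)
    (hl : l ≤ 1) {u y t : Param d} (hu : ‖u‖ ≤ 1) (hy : y ∈ Θ) (ht : t ∈ Θ) :
    ∫ τ, weightedEstim M pol e l u y t τ * trajDensity M pol t τ ∂(trajRef M) ≤
      inner ℝ u (meanEstim M pol e y) + 2 * G * l * D := by
  have hint1 : Integrable (fun τ => weightedEstim M pol e l u y t τ * trajDensity M pol t τ)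
      (trajRef M) :=
    integrable_mul_pathDensity (hpol.isPolicySeq (θ := fun _ => t) fun _ => ht)
      (measurable_weightedEstim hΘ hpol hreg e l hy)
      (abs_weightedEstim_le hpol hG hl0 hl hu hy ht)
  have hmean : inner ℝ u (meanEstim M pol e y) =
      ∫ τ, inner ℝ u (singleEstim M pol τ e y) * trajDensity M pol y τ ∂(trajRef M) := by
    rw [meanEstim, ← integral_inner
      (integrable_trajDensity_smul_singleEstim hΘ hpol hreg hG hy hy)]
    simp only [real_inner_smul_right, mul_comm]
  have hint2 : Integrable (fun τ => inner ℝ u (singleEstim M pol τ e y) * trajDensity M pol y τ)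
      (trajRef M) :=
    integrable_mul_pathDensity (hpol.isPolicySeq (θ := fun _ => y) fun _ => hy)
      (measurable_const.inner (measurable_singleEstim hΘ hpol hreg e hy))
      (abs_inner_singleEstim_le hG hu hy)
  have ip := integrable_trajDensity hpol ht
  have ip' := integrable_trajDensity hpol hy
  have ir := BoundedChiSq.integrable hpol hD hy ht
  have hval := BoundedChiSq.integral_le hpol hD hy ht
  have hG0 := hG.G_pos
  rw [← sub_le_iff_le_add', hmean, ← integral_sub hint1 hint2]
  calc _ ≤ ∫ τ, G * l * ((1 - l) * (trajDensity M pol y τ ^ 2 / trajDensity M pol t τ) +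
        l * trajDensity M pol y τ + ((1 - l) * trajDensity M pol y τ +
          l * trajDensity M pol t τ)) ∂(trajRef M) := by
        refine integral_mono (hint1.sub hint2)
          (((((ir.const_mul _).add (ip'.const_mul _)).add
            ((ip'.const_mul _).add (ip.const_mul _)))).const_mul _) fun τ => ?_
        have h1 := abs_powerWeight_mul_sub_le hl0 hl
          (trajDensity_pos_or_eq_zero (M := M) hreg ht hy τ)
        have h2 := abs_inner_singleEstim_le hG hu hy τ
        simp only [weightedEstim]
        calc _ = inner ℝ u (singleEstim M pol τ e y) *
              (powerWeight l (trajDensity M pol t τ) (trajDensity M pol y τ) *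
                trajDensity M pol t τ - trajDensity M pol y τ) := by ring
          _ ≤ _ := (le_abs_self _).trans (by
              rw [abs_mul, mul_assoc G]
              exact mul_le_mul h2 h1 (abs_nonneg _) hG0.le)
    _ ≤ 2 * G * l * D := by
        rw [integral_const_mul, integral_add ((ir.const_mul _).fun_add (ip'.const_mul _))
          ((ip'.const_mul _).fun_add (ip.const_mul _)), integral_add (ir.const_mul _)
          (ip'.const_mul _), integral_add (ip'.const_mul _) (ip.const_mul _)]
        simp only [integral_const_mul, integral_trajDensity hpol ht, integral_trajDensity hpol hy]
        have : (1 - l) * ∫ τ, trajDensity M pol y τ ^ 2 / trajDensity M pol t τ ∂(trajRef M) +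
            l * 1 + ((1 - l) * 1 + l * 1) ≤ 2 * D := by nlinarith [hD.one_le]
        calc _ ≤ G * l * (2 * D) := mul_le_mul_of_nonneg_left this (by positivity)
          _ = _ := by ring

/-- Exponential moment bound for the weighted estimator. -/
theorem integral_exp_weightedEstim_le {M : MDP S A T} {Θ : Set (Param d)} (hΘ : IsOpen Θ)
    {pol : Param d → S → A → ℝ} (hpol : IsPolicyClass M Θ pol)
    {L₁ L₂ : ℝ} (hreg : LogPolicyRegular Θ pol L₁ L₂) {D : ℝ} (hD : BoundedChiSq M Θ pol D)
    {e : EstimatorKind} {G G₂ : ℝ} (hG : EstimatorBounds M Θ pol e G G₂) {l : ℝ} (hl0 : 0 < l)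
    (hl : l ≤ 1) {u y t : Param d} (hu : ‖u‖ ≤ 1) (hy : y ∈ Θ) (ht : t ∈ Θ) :
    Integrable (fun τ => Real.exp (l / G * weightedEstim M pol e l u y t τ) *
        trajDensity M pol t τ) (trajRef M) ∧
    ∫ τ, Real.exp (l / G * weightedEstim M pol e l u y t τ) * trajDensity M pol t τ ∂(trajRef M) ≤
      Real.exp (l / G * inner ℝ u (meanEstim M pol e y) + 11 / 4 * l ^ 2 * D) := by
  have hG0 := hG.G_pos
  let f := weightedEstim M pol e l u y t
  have hfm : Measurable f := measurable_weightedEstim hΘ hpol hreg e l hy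
  have hfb := abs_weightedEstim_le hpol hG hl0 hl hu hy ht
  have hq : IsPolicySeq M fun _ : Fin T => pol t :=
    hpol.isPolicySeq (θ := fun _ => t) fun _ => ht
  -- The scale `l / G` is matched to the uniform bound `G / l`, so that the quadratic bound on `exp`
  -- applies.
  have hsf : ∀ τ, |l / G * f τ| ≤ 1 := by
    intro τ
    rw [abs_mul, abs_of_pos (by positivity)]
    calc _ ≤ l / G * (G / l) := mul_le_mul_of_nonneg_left (hfb τ) (by positivity)
      _ = 1 := by field_simp
  have i0 := integrable_trajDensity hpol ht
  have i1 : Integrable (fun τ => f τ * trajDensity M pol t τ) (trajRef M) :=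
    integrable_mul_pathDensity hq hfm hfb
  have i2 : Integrable (fun τ => f τ ^ 2 * trajDensity M pol t τ) (trajRef M) :=
    integrable_mul_pathDensity hq (hfm.pow_const 2) (c := (G / l) ^ 2) fun τ => by
      rw [abs_pow]
      exact pow_le_pow_left₀ (abs_nonneg _) (hfb τ) 2
  have iexp : Integrable (fun τ => Real.exp (l / G * f τ) * trajDensity M pol t τ) (trajRef M) :=
    integrable_mul_pathDensity hq (hfm.const_mul _).exp (c := Real.exp 1) fun τ => by
      rw [Real.abs_exp]
      exact Real.exp_le_exp.2 (abs_le.1 (hsf τ)).2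
  refine ⟨iexp, ?_⟩
  have b1 := integral_weightedEstim_le hΘ hpol hreg hD hG hl0 hl hu hy ht
  have b2 := integral_weightedEstim_sq_le hpol hreg hD hG hl0 hl hu hy ht
  calc _ ≤ ∫ τ, (trajDensity M pol t τ + l / G * (f τ * trajDensity M pol t τ) +
        3 / 4 * (l / G) ^ 2 * (f τ ^ 2 * trajDensity M pol t τ)) ∂(trajRef M) := by
        refine integral_mono iexp ((i0.add (i1.const_mul _)).add (i2.const_mul _)) fun τ => ?_
        have := mul_le_mul_of_nonneg_right (exp_le_quadratic (hsf τ))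
          (trajDensity_nonneg hpol ht τ)
        refine this.trans (le_of_eq ?_)
        ring
    _ = 1 + l / G * ∫ τ, f τ * trajDensity M pol t τ ∂(trajRef M) +
        3 / 4 * (l / G) ^ 2 * ∫ τ, f τ ^ 2 * trajDensity M pol t τ ∂(trajRef M) := by
        rw [integral_add (i0.fun_add (i1.const_mul _)) (i2.const_mul _),
          integral_add i0 (i1.const_mul _), integral_const_mul, integral_const_mul,
          integral_trajDensity hpol ht]
    _ ≤ 1 + l / G * (inner ℝ u (meanEstim M pol e y) + 2 * G * l * D) +
        3 / 4 * (l / G) ^ 2 * (G ^ 2 * D) := by gcongr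
    -- `11/4 = 2 + 3/4`: the bias contributes `2 l² D` and the second moment `3/4 l² D`.
    _ = (l / G * inner ℝ u (meanEstim M pol e y) + 11 / 4 * l ^ 2 * D) + 1 := by
        field_simp
        ring
    _ ≤ _ := Real.add_one_le_exp _

/-- The normalised exponential of the deviation of the weighted estimator, as a measurable function
of the target, the sampling parameter and the trajectory. -/
def tilt (M : MDP S A T) (Θ : Set (Param d)) (pol : Param d → S → A → ℝ) (e : EstimatorKind)
    (D G l : ℝ) (u : Param d) (x : (Param d × Param d) × Traj S A T) : ENNReal :=
  ENNReal.ofReal (Real.exp (l / G *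
    (powerWeight l (trajDensity M pol x.1.2 x.2) (trajDensity M pol x.1.1 x.2) *
      inner ℝ u (Θ.indicator (fun y => singleEstim M pol x.2 e y) x.1.1) -
      inner ℝ u (Θ.indicator (meanEstim M pol e) x.1.1)) - 11 / 4 * l ^ 2 * D))

theorem measurable_tilt {M : MDP S A T} {Θ : Set (Param d)} (hΘ : IsOpen Θ)
    {pol : Param d → S → A → ℝ} (hpol : IsPolicyClass M Θ pol)
    {L₁ L₂ : ℝ} (hreg : LogPolicyRegular Θ pol L₁ L₂) (e : EstimatorKind) (D G l : ℝ)
    (u : Param d) : Measurable (tilt M Θ pol e D G l u) := by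
  have hmean : Measurable (Θ.indicator (meanEstim M pol e)) := by
    have h1 : Θ.indicator (meanEstim M pol e) = fun y => ∫ τ, trajDensity M pol y τ •
        Θ.indicator (fun y => singleEstim M pol τ e y) y ∂(trajRef M) := by
      funext y
      by_cases hy : y ∈ Θ <;> simp [hy, meanEstim]
    rw [h1]
    exact (StronglyMeasurable.integral_prod_right
      ((measurable_trajDensity_uncurry hpol).smul
        (measurable_singleEstim_uncurry hΘ hpol hreg e)).stronglyMeasurable).measurable
  have hy : Measurable fun x : (Param d × Param d) × Traj S A T => (x.1.1, x.2) := by fun_prop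
  have ht : Measurable fun x : (Param d × Param d) × Traj S A T => (x.1.2, x.2) := by fun_prop
  have hpy := (measurable_trajDensity_uncurry hpol).comp hy
  have hpt := (measurable_trajDensity_uncurry hpol).comp ht
  have hg := (measurable_singleEstim_uncurry hΘ hpol hreg e).comp hy
  have hw : Measurable fun x : (Param d × Param d) × Traj S A T =>
      powerWeight l (trajDensity M pol x.1.2 x.2) (trajDensity M pol x.1.1 x.2) :=
    measurable_const.div (((hpt.div hpy).const_mul _).add_const _)
  have hm : Measurable fun x : (Param d × Param d) × Traj S A T =>
      Θ.indicator (meanEstim M pol e) x.1.1 := hmean.comp measurable_fst.fst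
  exact ((((hw.mul (measurable_const.inner hg)).sub
    (measurable_const.inner hm)).const_mul _).sub_const _).exp.ennreal_ofReal

/-- The terms subtracted inside `tilt` are the logarithm of the exponential moment bound, so each
sample multiplies the supermartingale by a factor of mean at most one. -/
theorem lintegral_tilt_le_one {M : MDP S A T} {Θ : Set (Param d)} (hΘ : IsOpen Θ)
    {pol : Param d → S → A → ℝ} (hpol : IsPolicyClass M Θ pol)
    {L₁ L₂ : ℝ} (hreg : LogPolicyRegular Θ pol L₁ L₂) {D : ℝ} (hD : BoundedChiSq M Θ pol D)
    {e : EstimatorKind} {G G₂ : ℝ} (hG : EstimatorBounds M Θ pol e G G₂) {l : ℝ} (hl0 : 0 < l)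
    (hl : l ≤ 1) {u y t : Param d} (hu : ‖u‖ ≤ 1) (hy : y ∈ Θ) (ht : t ∈ Θ) :
    ∫⁻ τ, tilt M Θ pol e D G l u ((y, t), τ) ∂(trajLaw M pol t) ≤ 1 := by
  obtain ⟨hint, hle⟩ := integral_exp_weightedEstim_le hΘ hpol hreg hD hG hl0 hl hu hy ht
  set c := l / G * inner ℝ u (meanEstim M pol e y) + 11 / 4 * l ^ 2 * D with hc
  have htm : Measurable fun τ => tilt M Θ pol e D G l u ((y, t), τ) :=
    (measurable_tilt hΘ hpol hreg e D G l u).comp measurable_prodMk_left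
  rw [trajLaw, lintegral_withDensity_eq_lintegral_mul _
    (measurable_trajDensity hpol t).ennreal_ofReal htm]
  have heq : ∀ τ, ((fun τ => ENNReal.ofReal (trajDensity M pol t τ)) *
      fun τ => tilt M Θ pol e D G l u ((y, t), τ)) τ = ENNReal.ofReal (Real.exp (-c) *
        (Real.exp (l / G * weightedEstim M pol e l u y t τ) * trajDensity M pol t τ)) := by
    intro τ
    simp only [Pi.mul_apply, tilt, Set.indicator_of_mem hy]
    rw [← ENNReal.ofReal_mul (trajDensity_nonneg hpol ht τ), ← mul_assoc, ← Real.exp_add,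
      mul_comm (trajDensity M pol t τ)]
    congr 3
    rw [hc, weightedEstim]
    ring
  rw [lintegral_congr heq, ← ofReal_integral_eq_lintegral_ofReal (hint.const_mul _)
    (ae_of_all _ fun τ => mul_nonneg (Real.exp_pos _).le
      (mul_nonneg (Real.exp_pos _).le (trajDensity_nonneg hpol ht τ))),
    integral_const_mul, ← ENNReal.ofReal_one]
  refine ENNReal.ofReal_le_ofReal ?_
  calc _ ≤ Real.exp (-c) * Real.exp c := by gcongr
    _ = 1 := by rw [← Real.exp_add]; simp

section Sampling

/-! ### Conditional sampling and the exponential supermartingale -/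

/-- Measurability is checked on boxes, which suffices for probability measures. The map into `Θ` is
needed because `trajLaw` is known to be a probability measure only there. -/
theorem measurable_pi_trajLaw {M : MDP S A T} {Θ : Set (Param d)}
    {pol : Param d → S → A → ℝ} (hpol : IsPolicyClass M Θ pol) (N : ℕ) {φ : Param d → Param d}
    (hφ : Measurable φ) (hφΘ : ∀ θ, φ θ ∈ Θ) :
    Measurable fun θ => Measure.pi fun _ : Fin N => trajLaw M pol (φ θ) := by
  have hprob : ∀ θ, IsProbabilityMeasure (trajLaw M pol (φ θ)) := fun θ =>
    isProbabilityMeasure_trajLaw hpol (hφΘ θ)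
  have h1 : ∀ B : Set (Traj S A T), MeasurableSet B →
      Measurable fun θ => trajLaw M pol (φ θ) B := by
    intro B hB
    simp only [trajLaw, withDensity_apply _ hB]
    refine Measurable.lintegral_prod_right' (f := fun x : Param d × Traj S A T =>
      ENNReal.ofReal (trajDensity M pol (φ x.1) x.2)) ?_
    exact ((measurable_trajDensity_uncurry hpol).comp
      ((hφ.comp measurable_fst).prodMk measurable_snd)).ennreal_ofReal
  refine Measurable.measure_of_isPiSystem_of_isProbabilityMeasure generateFrom_pi.symm
    isPiSystem_pi ?_
  rintro _ ⟨s, hs, rfl⟩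
  simp only [Measure.pi_pi]
  exact Finset.measurable_fun_prod _ fun j _ => h1 _ (hs j (Set.mem_univ j))

theorem lintegral_prod_pi_le_one {X : Type*} [MeasurableSpace X] {N : ℕ} {μ : Measure X}
    [IsProbabilityMeasure μ] {f : X → ENNReal} (hf : Measurable f) (h : ∫⁻ x, f x ∂μ ≤ 1) :
    ∫⁻ b : Fin N → X, ∏ j, f (b j) ∂(Measure.pi fun _ => μ) ≤ 1 := by
  have hind : ProbabilityTheory.iIndepFun (fun (j : Fin N) (b : Fin N → X) => f (b j))
      (Measure.pi fun _ => μ) :=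
    ProbabilityTheory.iIndepFun_pi (X := fun _ => f) fun _ => hf.aemeasurable
  rw [ProbabilityTheory.lintegral_prod_eq_prod_lintegral_of_indepFun Finset.univ _ hind
    fun j => hf.comp (measurable_pi_apply j)]
  refine Finset.prod_le_one' fun j _ => ?_
  have hmp := measurePreserving_eval (fun _ : Fin N => μ) j
  exact (hmp.lintegral_comp hf).trans_le h

variable {Ω : Type*} {N : ℕ}

theorem measurable_param_pastSigma (θ : ℕ → Ω → Param d) (τ : ℕ → Fin N → Ω → Traj S A T)
    {z i : ℕ} (hz : z ∈ Finset.Icc 1 i) : Measurable[pastSigma θ τ i] (θ z) :=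
  measurable_iff_comap_le.2 (le_sup_of_le_left (le_iSup₂_of_le z hz le_rfl))

theorem measurable_traj_pastSigma (θ : ℕ → Ω → Param d) (τ : ℕ → Fin N → Ω → Traj S A T)
    {z i : ℕ} (hz : z ∈ Finset.Ico 1 i) (j : Fin N) : Measurable[pastSigma θ τ i] (τ z j) := by
  have h : Measurable[pastSigma θ τ i] (fun x (j : Fin N) => τ z j x) :=
    measurable_iff_comap_le.2 (le_sup_of_le_right (le_iSup₂_of_le z hz le_rfl))
  exact (measurable_pi_apply j).comp h

variable [MeasurableSpace Ω]

theorem IsHistory.pastSigma_le {M : MDP S A T} {Θ : Set (Param d)} {pol : Param d → S → A → ℝ}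
    {e : EstimatorKind} {w k : ℕ} {α lam : ℕ → ℕ → ℝ} {ζ : ℕ → ℝ} {P : Measure Ω}
    {θ : ℕ → Ω → Param d} {τ : ℕ → Fin N → Ω → Traj S A T}
    (hist : IsHistory M Θ pol e w α lam ζ k P θ τ) {i : ℕ} (hi : i ≤ k) :
    pastSigma θ τ i ≤ ‹MeasurableSpace Ω› := by
  refine sup_le (iSup₂_le fun z hz => ?_) (iSup₂_le fun z hz => ?_)
  · rw [Finset.mem_Icc] at hz
    exact (hist.measurable_param z (Finset.mem_Icc.2 ⟨hz.1, by omega⟩)).comap_le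
  · rw [Finset.mem_Ico] at hz
    exact (measurable_pi_lambda _ fun j =>
      hist.measurable_traj z (Finset.mem_Icc.2 ⟨hz.1, by omega⟩) j).comap_le

/-- Integration of a function of the past and of the batch of iteration `i`. -/
theorem IsHistory.lintegral_batch {M : MDP S A T} {Θ : Set (Param d)} (hΘ : IsOpen Θ)
    {pol : Param d → S → A → ℝ} (hpol : IsPolicyClass M Θ pol)
    {e : EstimatorKind} {w k : ℕ} {α lam : ℕ → ℕ → ℝ} {ζ : ℕ → ℝ} {P : Measure Ω}
    [IsProbabilityMeasure P] {θ : ℕ → Ω → Param d} {τ : ℕ → Fin N → Ω → Traj S A T}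
    (hist : IsHistory M Θ pol e w α lam ζ k P θ τ) {i : ℕ} (hi : i ∈ Finset.Icc 1 k)
    {E : Type*} [MeasurableSpace E] {W : Ω → E} (hW : Measurable[pastSigma θ τ i] W)
    {pr : E → Param d} (hpr : Measurable pr) (hprW : ∀ x, pr (W x) = θ i x)
    {Φ : E × (Fin N → Traj S A T) → ENNReal} (hΦ : Measurable Φ) :
    ∫⁻ x, Φ (W x, fun j => τ i j x) ∂P =
      ∫⁻ x, ∫⁻ b, Φ (W x, b) ∂(Measure.pi fun _ : Fin N => trajLaw M pol (θ i x)) ∂P := by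
  classical
  have hik : i ≤ k := (Finset.mem_Icc.1 hi).2
  have hW' : Measurable W := hW.mono (hist.pastSigma_le hik) le_rfl
  have hτ : Measurable fun x (j : Fin N) => τ i j x :=
    measurable_pi_lambda _ fun j => hist.measurable_traj i hi j
  obtain ⟨x₀, hx₀⟩ := (hist.param_mem i hi).exists
  -- The iterate lies in `Θ` only almost surely; redirecting the exceptional values to a fixed point
  -- of `Θ` gives a Markov kernel defined everywhere.
  let φ : Param d → Param d := fun t => if t ∈ Θ then t else θ i x₀
  have hφ : Measurable φ := Measurable.ite hΘ.measurableSet measurable_id measurable_const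
  have hφΘ : ∀ t, φ t ∈ Θ := by
    intro t
    simp only [φ]
    split_ifs
    exacts [‹_›, hx₀]
  have hprob : ∀ t, IsProbabilityMeasure (trajLaw M pol (φ t)) := fun t =>
    isProbabilityMeasure_trajLaw hpol (hφΘ t)
  let κ : ProbabilityTheory.Kernel E (Fin N → Traj S A T) :=
    ⟨fun w => Measure.pi fun _ : Fin N => trajLaw M pol (φ (pr w)),
      (measurable_pi_trajLaw hpol N hφ hφΘ).comp hpr⟩
  have hκ : ∀ w, κ w = Measure.pi fun _ : Fin N => trajLaw M pol (φ (pr w)) := fun _ => rfl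
  have hmarkov : ProbabilityTheory.IsMarkovKernel κ := ⟨fun w => by rw [hκ]; infer_instance⟩
  have hae : ∀ᵐ x ∂P, κ (W x) = Measure.pi fun _ : Fin N => trajLaw M pol (θ i x) := by
    filter_upwards [hist.param_mem i hi] with x hx
    simp only [hκ, hprW, φ, if_pos hx]
  -- The sampling axiom, read on rectangles, says that the past and the batch have the
  -- composition-product as joint law.
  have hmap : P.map (fun x => (W x, fun j => τ i j x)) = (P.map W).compProd κ := by
    have : IsProbabilityMeasure (P.map fun x => (W x, fun j => τ i j x)) :=
      Measure.isProbabilityMeasure_map (hW'.prodMk hτ).aemeasurable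
    have : IsProbabilityMeasure (P.map W) := Measure.isProbabilityMeasure_map hW'.aemeasurable
    refine Measure.ext_prod fun {s t} hs ht => ?_
    rw [Measure.map_apply (hW'.prodMk hτ) (hs.prod ht), Measure.compProd_apply_prod hs ht,
      setLIntegral_map hs (κ.measurable_coe ht) hW']
    refine (hist.sampling i hi (W ⁻¹' s) (hW hs) t ht).trans ?_
    refine lintegral_congr_ae (ae_restrict_of_ae ?_)
    filter_upwards [hae] with x hx
    rw [hx]
  calc _ = ∫⁻ y, Φ y ∂(P.map fun x => (W x, fun j => τ i j x)) :=
        (lintegral_map hΦ (hW'.prodMk hτ)).symm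
    _ = ∫⁻ x, ∫⁻ b, Φ (W x, b) ∂(κ (W x)) ∂P := by
        have : IsProbabilityMeasure (P.map W) := Measure.isProbabilityMeasure_map hW'.aemeasurable
        rw [hmap, Measure.lintegral_compProd hΦ,
          lintegral_map hΦ.lintegral_kernel_prod_right' hW']
    _ = _ := by
        refine lintegral_congr_ae ?_
        filter_upwards [hae] with x hx
        rw [hx]

/-- The exponential supermartingale of the window, for a target which is a function of the first
parameter of the window. -/
theorem IsHistory.lintegral_prod_tilt_le_one {M : MDP S A T} {Θ : Set (Param d)} (hΘ : IsOpen Θ)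
    {pol : Param d → S → A → ℝ} (hpol : IsPolicyClass M Θ pol)
    {L₁ L₂ : ℝ} (hreg : LogPolicyRegular Θ pol L₁ L₂) {D : ℝ} (hD : BoundedChiSq M Θ pol D)
    {e : EstimatorKind} {G G₂ : ℝ} (hG : EstimatorBounds M Θ pol e G G₂) {l : ℝ} (hl0 : 0 < l)
    (hl : l ≤ 1) {u : Param d} (hu : ‖u‖ ≤ 1)
    {w k : ℕ} {α lam : ℕ → ℕ → ℝ} {ζ : ℕ → ℝ} {P : Measure Ω}
    [IsProbabilityMeasure P] {θ : ℕ → Ω → Param d} {τ : ℕ → Fin N → Ω → Traj S A T}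
    (hist : IsHistory M Θ pol e w α lam ζ k P θ τ) {k₀ : ℕ} (hk₀ : 1 ≤ k₀)
    {φ : Param d → Param d} (hφ : Measurable φ) (hφΘ : ∀ t, φ t ∈ Θ) {m : ℕ} (hm : k₀ ≤ m)
    (hmk : m ≤ k + 1) :
    ∫⁻ x, ∏ i ∈ Finset.Ico k₀ m, ∏ j : Fin N,
      tilt M Θ pol e D G l u ((φ (θ k₀ x), θ i x), τ i j x) ∂P ≤ 1 := by
  induction m, hm using Nat.le_induction with
  | base => simp
  | succ m hm ih =>
    have ih := ih (by omega)
    have hmm : m ∈ Finset.Icc 1 k := Finset.mem_Icc.2 ⟨by omega, by omega⟩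
    have htilt := measurable_tilt (D := D) (G := G) (l := l) (u := u) hΘ hpol hreg e
    -- All that the new batch needs from the past: the product so far, the target and the sampling
    -- parameter. The target is a function of `θ k₀`, hence known before every batch of the window.
    let W : Ω → ENNReal × Param d × Param d := fun x =>
      (∏ i ∈ Finset.Ico k₀ m, ∏ j : Fin N,
        tilt M Θ pol e D G l u ((φ (θ k₀ x), θ i x), τ i j x), φ (θ k₀ x), θ m x)
    have hθ0 : Measurable[pastSigma θ τ m] fun x => φ (θ k₀ x) :=
      hφ.comp (measurable_param_pastSigma θ τ (Finset.mem_Icc.2 ⟨hk₀, hm⟩))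
    have hW : Measurable[pastSigma θ τ m] W := by
      refine Measurable.prodMk (Finset.measurable_fun_prod _ fun i hi =>
        Finset.measurable_fun_prod _ fun j _ => ?_) (hθ0.prodMk (measurable_param_pastSigma θ τ
          (Finset.mem_Icc.2 ⟨by omega, le_rfl⟩)))
      rw [Finset.mem_Ico] at hi
      exact htilt.comp ((hθ0.prodMk (measurable_param_pastSigma θ τ
        (Finset.mem_Icc.2 ⟨by omega, by omega⟩))).prodMk
        (measurable_traj_pastSigma θ τ (Finset.mem_Ico.2 ⟨by omega, by omega⟩) j))
    let Φ : (ENNReal × Param d × Param d) × (Fin N → Traj S A T) → ENNReal := fun p =>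
      p.1.1 * ∏ j, tilt M Θ pol e D G l u (p.1.2, p.2 j)
    have hprod : Measurable fun p : (ENNReal × Param d × Param d) × (Fin N → Traj S A T) =>
        ∏ j, tilt M Θ pol e D G l u (p.1.2, p.2 j) :=
      Finset.measurable_fun_prod _ fun j _ => htilt.comp
        (measurable_fst.snd.prodMk ((measurable_pi_apply j).comp measurable_snd))
    have hΦ : Measurable Φ := measurable_fst.fst.mul hprod
    have hbatch := hist.lintegral_batch hΘ hpol hmm hW
      (measurable_snd.snd : Measurable fun p : ENNReal × Param d × Param d => p.2.2)
      (fun _ => rfl) hΦ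
    simp only [Finset.prod_Ico_succ_top hm]
    refine hbatch.trans_le (le_trans (lintegral_mono_ae ?_) ih)
    filter_upwards [hist.param_mem m hmm] with x hx
    have := isProbabilityMeasure_trajLaw hpol hx
    simp only [Φ, W]
    have hpx : Measurable fun b : Fin N → Traj S A T =>
        ∏ j, tilt M Θ pol e D G l u ((φ (θ k₀ x), θ m x), b j) :=
      Finset.measurable_fun_prod _ fun j _ =>
        htilt.comp (measurable_const.prodMk (measurable_pi_apply j))
    rw [lintegral_const_mul _ hpx]
    refine mul_le_of_le_one_right' (lintegral_prod_pi_le_one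
      (f := fun τ => tilt M Θ pol e D G l u ((φ (θ k₀ x), θ m x), τ))
      (htilt.comp measurable_prodMk_left) ?_)
    exact lintegral_tilt_le_one hΘ hpol hreg hD hG hl0 hl hu (hφΘ _) hx

/-- Deviation bound in a fixed direction for a target which is a function of the first parameter
of the window. -/
theorem IsHistory.measure_deviation_le {M : MDP S A T} {Θ : Set (Param d)} (hΘ : IsOpen Θ)
    {pol : Param d → S → A → ℝ} (hpol : IsPolicyClass M Θ pol)
    {L₁ L₂ : ℝ} (hreg : LogPolicyRegular Θ pol L₁ L₂) {D : ℝ} (hD : BoundedChiSq M Θ pol D)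
    {e : EstimatorKind} {G G₂ : ℝ} (hG : EstimatorBounds M Θ pol e G G₂) {l : ℝ} (hl0 : 0 < l)
    (hl : l ≤ 1) {u : Param d} (hu : ‖u‖ ≤ 1)
    {w k : ℕ} {α lam : ℕ → ℕ → ℝ} {ζ : ℕ → ℝ} {P : Measure Ω}
    [IsProbabilityMeasure P] {θ : ℕ → Ω → Param d} {τ : ℕ → Fin N → Ω → Traj S A T}
    (hist : IsHistory M Θ pol e w α lam ζ k P θ τ) {k₀ : ℕ} (hk₀ : 1 ≤ k₀) (hk : k₀ ≤ k)
    {φ : Param d → Param d} (hφ : Measurable φ) (hφΘ : ∀ t, φ t ∈ Θ) (C : ℝ) :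
    P {x | C ≤ ∑ i ∈ Finset.Icc k₀ k, ∑ j : Fin N, (l / G *
        (weightedEstim M pol e l u (φ (θ k₀ x)) (θ i x) (τ i j x) -
          inner ℝ u (meanEstim M pol e (φ (θ k₀ x)))) - 11 / 4 * l ^ 2 * D)} ≤
      ENNReal.ofReal (Real.exp (-C)) := by
  have htilt := measurable_tilt (D := D) (G := G) (l := l) (u := u) hΘ hpol hreg e
  have hθ := fun i (hi : i ∈ Finset.Icc k₀ k) => hist.measurable_param i
    (Finset.mem_Icc.2 ⟨hk₀.trans (Finset.mem_Icc.1 hi).1, (Finset.mem_Icc.1 hi).2⟩)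
  have hτ := fun i (hi : i ∈ Finset.Icc k₀ k) => hist.measurable_traj i
    (Finset.mem_Icc.2 ⟨hk₀.trans (Finset.mem_Icc.1 hi).1, (Finset.mem_Icc.1 hi).2⟩)
  let Z : Ω → ENNReal := fun x => ∏ i ∈ Finset.Icc k₀ k, ∏ j : Fin N,
    tilt M Θ pol e D G l u ((φ (θ k₀ x), θ i x), τ i j x)
  have hZ : Measurable Z := Finset.measurable_fun_prod _ fun i hi =>
    Finset.measurable_fun_prod _ fun j _ => htilt.comp
      (((hφ.comp (hθ k₀ (Finset.mem_Icc.2 ⟨le_rfl, hk⟩))).prodMk (hθ i hi)).prodMk (hτ i hi j))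
  have hZ1 : ∫⁻ x, Z x ∂P ≤ 1 := by
    have := hist.lintegral_prod_tilt_le_one hΘ hpol hreg hD hG hl0 hl hu hk₀ hφ hφΘ
      (m := k + 1) (by omega) le_rfl
    have hI : Finset.Ico k₀ (k + 1) = Finset.Icc k₀ k := by
      ext i; simp
    simpa only [hI, Z] using this
  have hexp : ∀ x, Z x = ENNReal.ofReal (Real.exp (∑ i ∈ Finset.Icc k₀ k, ∑ j : Fin N, (l / G *
        (weightedEstim M pol e l u (φ (θ k₀ x)) (θ i x) (τ i j x) -
          inner ℝ u (meanEstim M pol e (φ (θ k₀ x)))) - 11 / 4 * l ^ 2 * D))) := by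
    intro x
    simp only [Real.exp_sum]
    rw [ENNReal.ofReal_prod_of_nonneg fun i _ => Finset.prod_nonneg fun j _ => (Real.exp_pos _).le]
    refine Finset.prod_congr rfl fun i _ => ?_
    rw [ENNReal.ofReal_prod_of_nonneg fun j _ => (Real.exp_pos _).le]
    refine Finset.prod_congr rfl fun j _ => ?_
    simp only [tilt, weightedEstim, Set.indicator_of_mem (hφΘ _)]
  -- Markov's inequality for the product `Z`, whose mean is at most one.
  have hmk := mul_meas_ge_le_lintegral hZ (μ := P) (ENNReal.ofReal (Real.exp C))
  have hset : {x | ENNReal.ofReal (Real.exp C) ≤ Z x} =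
      {x | C ≤ ∑ i ∈ Finset.Icc k₀ k, ∑ j : Fin N, (l / G *
        (weightedEstim M pol e l u (φ (θ k₀ x)) (θ i x) (τ i j x) -
          inner ℝ u (meanEstim M pol e (φ (θ k₀ x)))) - 11 / 4 * l ^ 2 * D)} := by
    ext x
    simp only [Set.mem_ofPred_eq, hexp, ENNReal.ofReal_le_ofReal_iff (Real.exp_pos _).le,
      Real.exp_le_exp]
  rw [hset] at hmk
  rw [Real.exp_neg, ENNReal.ofReal_inv_of_pos (Real.exp_pos C)]
  rw [ENNReal.le_inv_iff_mul_le, mul_comm]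
  exact hmk.trans hZ1

end Sampling

/-! ### Deterministic bounds for the multiple power mean estimate -/

theorem winStart_le {w k : ℕ} (hw : 1 ≤ w) (hk : 1 ≤ k) : winStart w k ≤ k := by
  have h1 : 1 ≤ win w k := le_min hw hk
  have h2 : win w k ≤ k := min_le_right _ _
  unfold winStart
  omega

theorem card_window (w k : ℕ) : (Finset.Icc (winStart w k) k).card = win w k := by
  have h2 : win w k ≤ k := min_le_right _ _
  rw [Nat.card_Icc]
  unfold winStart
  omega

/-- A measurable choice of a point of `Θ` near a translate, whenever there is one. -/
theorem exists_measurable_selection {E : Type*} [NormedAddCommGroup E] [MeasurableSpace E]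
    [BorelSpace E] [SecondCountableTopology E] {Θ : Set E} (hΘ : IsOpen Θ) {θ₀ : E} (hθ₀ : θ₀ ∈ Θ)
    (v : E) (η : ℝ) :
    ∃ φ : E → E, Measurable φ ∧ (∀ t, φ t ∈ Θ) ∧
      ∀ t, ∀ y ∈ Θ, dist y (t + v) < η → dist (φ t) (t + v) < η := by
  classical
  -- The selection takes the first point of a dense sequence that lies in `Θ` and in the ball about
  -- `t + v`. In `p` every index is accepted when no such point exists, and the value is then `θ₀`.
  let q : ℕ → E → Prop := fun n t => TopologicalSpace.denseSeq E n ∈ Θ ∧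
    dist (TopologicalSpace.denseSeq E n) (t + v) < η
  let p : ℕ → E → Prop := fun n t => q n t ∨ ¬ ∃ m, q m t
  let f : ℕ → E → E := fun n t => if q n t then TopologicalSpace.denseSeq E n else θ₀
  have hq : ∀ n, MeasurableSet {t | q n t} := fun n =>
    (MeasurableSet.const _).inter
      (isOpen_lt (continuous_const.dist (continuous_id.add continuous_const))
        continuous_const).measurableSet
  have hqex : MeasurableSet {t | ∃ m, q m t} := by
    have : {t | ∃ m, q m t} = ⋃ m, {t | q m t} := by ext; simp
    rw [this]
    exact MeasurableSet.iUnion hq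
  have hex : ∀ t, ∃ n, p n t := fun t => by
    by_cases h : ∃ m, q m t
    · exact h.imp fun m hm => Or.inl hm
    · exact ⟨0, Or.inr h⟩
  refine ⟨fun t => f (Nat.find (hex t)) t,
    Measurable.find (p := p) (fun n => Measurable.ite (hq n) measurable_const measurable_const)
      (fun n => (hq n).union hqex.compl) hex, fun t => ?_, fun t y hy hd => ?_⟩
  · simp only [f]
    split_ifs with h
    exacts [h.1, hθ₀]
  · have hopen : IsOpen (Θ ∩ Metric.ball (t + v) η) := hΘ.inter Metric.isOpen_ball
    obtain ⟨m, hm⟩ := (TopologicalSpace.denseRange_denseSeq E).exists_mem_open hopen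
      ⟨y, hy, Metric.mem_ball.2 hd⟩
    have hqm : ∃ m, q m t := ⟨m, hm.1, Metric.mem_ball.1 hm.2⟩
    have hfind : q (Nat.find (hex t)) t := (Nat.find_spec (hex t)).resolve_right (not_not.2 hqm)
    simp only [f, if_pos hfind]
    exact hfind.2

/-- The weight is `1/l`-Lipschitz in the logarithm of the target density. For `x ≥ 0` this is `1 -
exp (-x) ≤ x`; the other sign follows by exchanging the roles of `a` and `a exp (-x)`. -/
theorem abs_one_div_exp_sub_le {a l : ℝ} (ha : 0 ≤ a) (hl : 0 < l) (x : ℝ) :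
    |1 / (a * Real.exp (-x) + l) - 1 / (a + l)| ≤ |x| / l := by
  have key : ∀ {a x : ℝ}, 0 ≤ a → 0 ≤ x →
      |1 / (a * Real.exp (-x) + l) - 1 / (a + l)| ≤ x / l := by
    intro a x ha hx
    have h1 : 0 < a * Real.exp (-x) + l := by positivity
    have h2 : 0 < a + l := by positivity
    have h3 : Real.exp (-x) ≤ 1 := Real.exp_le_one_iff.2 (by linarith)
    have h4 := Real.add_one_le_exp (-x)
    have heq : 1 / (a * Real.exp (-x) + l) - 1 / (a + l) =
        (a * (1 - Real.exp (-x))) / ((a * Real.exp (-x) + l) * (a + l)) := by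
      rw [div_sub_div _ _ h1.ne' h2.ne']
      congr 1
      ring
    have hnum : 0 ≤ a * (1 - Real.exp (-x)) := mul_nonneg ha (by linarith)
    rw [heq, abs_of_nonneg (div_nonneg hnum (by positivity)), div_le_div_iff₀ (by positivity) hl]
    calc a * (1 - Real.exp (-x)) * l ≤ (a + l) * x * (a * Real.exp (-x) + l) := by
          refine mul_le_mul (mul_le_mul (by linarith) (by linarith) (by linarith) h2.le) ?_ hl.le
            (by positivity)
          have : 0 ≤ a * Real.exp (-x) := by positivity
          linarith
      _ = _ := by ring
  rcases le_total 0 x with hx | hx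
  · rw [abs_of_nonneg hx]
    exact key ha hx
  · have h := key (a := a * Real.exp (-x)) (x := -x) (by positivity) (by linarith)
    rw [neg_neg, mul_assoc, ← Real.exp_add, neg_add_cancel, Real.exp_zero, mul_one,
      abs_sub_comm] at h
    rwa [abs_of_nonpos hx]

theorem abs_powerWeight_sub_le {M : MDP S A T} {Θ : Set (Param d)} (hconv : Convex ℝ Θ)
    {pol : Param d → S → A → ℝ} (hpol : IsPolicyClass M Θ pol)
    {L₁ L₂ : ℝ} (hreg : LogPolicyRegular Θ pol L₁ L₂) {l : ℝ} (hl0 : 0 < l) (hl : l ≤ 1)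
    {t y y' : Param d} (ht : t ∈ Θ) (hy : y ∈ Θ) (hy' : y' ∈ Θ) (τ : Traj S A T) :
    |powerWeight l (trajDensity M pol t τ) (trajDensity M pol y' τ) -
      powerWeight l (trajDensity M pol t τ) (trajDensity M pol y τ)| ≤
      T * L₁ * ‖y' - y‖ / l := by
  have hmix := pathDensity_mixed_eq (M := M) hreg Finset.univ hy' hy τ
  simp only [Finset.mem_univ, if_true] at hmix
  set x := ∑ s : Fin T, (Real.log (pol y' (τ s).1 (τ s).2) - Real.log (pol y (τ s).1 (τ s).2))
  have hp : trajDensity M pol y' τ = trajDensity M pol y τ * Real.exp x := hmix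
  have hx : |x| ≤ T * L₁ * ‖y' - y‖ := by
    refine (Finset.abs_sum_le_sum_abs _ _).trans
      ((Finset.sum_le_sum fun s _ => hreg.abs_log_sub_le hconv hy hy' _ _).trans (le_of_eq ?_))
    simp
    ring
  have ha : 0 ≤ (1 - l) * (trajDensity M pol t τ / trajDensity M pol y τ) :=
    mul_nonneg (by linarith)
      (div_nonneg (trajDensity_nonneg hpol ht τ) (trajDensity_nonneg hpol hy τ))
  have h := abs_one_div_exp_sub_le ha hl0 x
  have heq : (1 - l) * (trajDensity M pol t τ / trajDensity M pol y' τ) =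
      (1 - l) * (trajDensity M pol t τ / trajDensity M pol y τ) * Real.exp (-x) := by
    rw [hp, Real.exp_neg, div_mul_eq_div_div]
    ring
  unfold powerWeight
  rw [heq]
  exact h.trans (by gcongr)

theorem norm_powerWeight_smul_sub_le {M : MDP S A T} {Θ : Set (Param d)} (hconv : Convex ℝ Θ)
    {pol : Param d → S → A → ℝ} (hpol : IsPolicyClass M Θ pol)
    {L₁ L₂ : ℝ} (hreg : LogPolicyRegular Θ pol L₁ L₂) {e : EstimatorKind} {G G₂ : ℝ}
    (hG : EstimatorBounds M Θ pol e G G₂) {l : ℝ} (hl0 : 0 < l) (hl : l ≤ 1)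
    {t y y' : Param d} (ht : t ∈ Θ) (hy : y ∈ Θ) (hy' : y' ∈ Θ) (τ : Traj S A T) :
    ‖powerWeight l (trajDensity M pol t τ) (trajDensity M pol y' τ) • singleEstim M pol τ e y' -
      powerWeight l (trajDensity M pol t τ) (trajDensity M pol y τ) • singleEstim M pol τ e y‖ ≤
      (G * T * L₁ + G₂) / l * ‖y' - y‖ := by
  have h1 := abs_powerWeight_sub_le hconv hpol hreg hl0 hl ht hy hy' τ
  have h2 := norm_singleEstim_sub_le hconv hreg hG hy hy' τ
  have h3 := hG.norm_le y hy τ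
  have h4 := powerWeight_le hl0 hl (trajDensity_nonneg hpol ht τ) (trajDensity_nonneg hpol hy' τ)
  have h5 := powerWeight_nonneg hl0 hl (trajDensity_nonneg hpol ht τ)
    (trajDensity_nonneg hpol hy' τ)
  set a := powerWeight l (trajDensity M pol t τ) (trajDensity M pol y' τ)
  set b := powerWeight l (trajDensity M pol t τ) (trajDensity M pol y τ)
  set g := singleEstim M pol τ e y
  set g' := singleEstim M pol τ e y'
  have heq : a • g' - b • g = a • (g' - g) + (a - b) • g := by
    rw [smul_sub, sub_smul]; abel
  rw [heq]
  refine (norm_add_le _ _).trans ?_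
  rw [norm_smul, norm_smul, Real.norm_of_nonneg h5, Real.norm_eq_abs]
  have hG0 := hG.G_pos
  have hG2 := hG.G₂_pos
  calc _ ≤ 1 / l * (G₂ * ‖y' - y‖) + T * L₁ * ‖y' - y‖ / l * G :=
        add_le_add (mul_le_mul h4 h2 (norm_nonneg _) (by positivity))
          (mul_le_mul h1 h3 (norm_nonneg _) ((abs_nonneg _).trans h1))
    _ = _ := by ring

/-- The average of `win w k * N` vectors of norm at most `B`, in the form of the estimate. -/
theorem norm_window_average_le {E : Type*} [NormedAddCommGroup E] [NormedSpace ℝ E] {N w k : ℕ}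
    {v : ℕ → Fin N → E} {B : ℝ} (hB : 0 ≤ B)
    (hv : ∀ i ∈ Finset.Icc (winStart w k) k, ∀ j, ‖v i j‖ ≤ B) :
    ‖∑ i ∈ Finset.Icc (winStart w k) k, (1 / (N : ℝ)) • ∑ j : Fin N,
      (1 / (win w k : ℝ)) • v i j‖ ≤ B := by
  have h : ∀ i ∈ Finset.Icc (winStart w k) k, ‖(1 / (N : ℝ)) • ∑ j : Fin N,
      (1 / (win w k : ℝ)) • v i j‖ ≤ 1 / (win w k : ℝ) * B := by
    intro i hi
    rw [← Finset.smul_sum, norm_smul, norm_smul, Real.norm_of_nonneg (by positivity),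
      Real.norm_of_nonneg (by positivity)]
    have hs : ‖∑ j, v i j‖ ≤ N * B :=
      (norm_sum_le_of_le _ fun j _ => hv i hi j).trans (by simp)
    calc _ ≤ 1 / (N : ℝ) * (1 / (win w k : ℝ) * (N * B)) := by gcongr
      _ = (1 / (N : ℝ) * N) * (1 / (win w k : ℝ) * B) := by ring
      -- An inequality rather than an equality, so that `N = 0` need not be excluded.
      _ ≤ 1 * (1 / (win w k : ℝ) * B) := by
          gcongr
          rw [one_div]
          exact inv_mul_le_one
      _ = _ := one_mul _
  refine (norm_sum_le_of_le _ h).trans ?_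
  rw [Finset.sum_const, card_window, nsmul_eq_mul, ← mul_assoc, one_div]
  calc _ ≤ 1 * B := by gcongr; exact mul_inv_le_one
    _ = B := one_mul B

theorem mpm_eq {M : MDP S A T} {pol : Param d → S → A → ℝ} {e : EstimatorKind} {N w : ℕ}
    {α lam : ℕ → ℕ → ℝ} {θ : ℕ → Param d} {τ : ℕ → Fin N → Traj S A T} {k : ℕ}
    (hα : ∀ i ∈ Finset.Icc (winStart w k) k, α i k = 1 / (win w k : ℝ)) (y : Param d) :
    mpm M pol e w α lam θ τ k y = ∑ i ∈ Finset.Icc (winStart w k) k, (1 / (N : ℝ)) •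
      ∑ j : Fin N, (1 / (win w k : ℝ)) • (powerWeight (lam i k) (trajDensity M pol (θ i) (τ i j))
        (trajDensity M pol y (τ i j)) • singleEstim M pol (τ i j) e y) := by
  unfold mpm
  refine Finset.sum_congr rfl fun i hi => ?_
  rw [hα i hi]
  congr 1
  refine Finset.sum_congr rfl fun j _ => ?_
  rw [smul_smul, powerWeight]
  congr 1
  ring

/-- Weights bounded by `1/l` make every update bounded, whatever the trajectories; the displacement
over a window is controlled through this. -/
theorem norm_mpm_le {M : MDP S A T} {Θ : Set (Param d)}
    {pol : Param d → S → A → ℝ} (hpol : IsPolicyClass M Θ pol) {e : EstimatorKind} {G G₂ : ℝ}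
    (hG : EstimatorBounds M Θ pol e G G₂) {N w k : ℕ}
    {α lam : ℕ → ℕ → ℝ} {θ : ℕ → Param d} {τ : ℕ → Fin N → Traj S A T}
    (hα : ∀ i ∈ Finset.Icc (winStart w k) k, α i k = 1 / (win w k : ℝ))
    {l : ℝ} (hl0 : 0 < l)
    (hlam : ∀ i ∈ Finset.Icc (winStart w k) k, l ≤ lam i k ∧ lam i k ≤ 1)
    (hθ : ∀ i ∈ Finset.Icc (winStart w k) k, θ i ∈ Θ) {y : Param d} (hy : y ∈ Θ) :
    ‖mpm M pol e w α lam θ τ k y‖ ≤ G / l := by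
  have hG0 := hG.G_pos
  rw [mpm_eq hα]
  refine norm_window_average_le (by positivity) fun i hi j => ?_
  obtain ⟨h1, h2⟩ := hlam i hi
  have hp := trajDensity_nonneg hpol (hθ i hi) (τ i j)
  have hp' := trajDensity_nonneg hpol hy (τ i j)
  have hl1 : 0 < lam i k := hl0.trans_le h1
  rw [norm_smul, Real.norm_of_nonneg (powerWeight_nonneg hl1 h2 hp hp')]
  calc _ ≤ 1 / l * G := mul_le_mul ((powerWeight_le hl1 h2 hp hp').trans
        (one_div_le_one_div_of_le hl0 h1)) (hG.norm_le y hy _) (norm_nonneg _) (by positivity)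
    _ = G / l := by ring

theorem norm_mpm_sub_le {M : MDP S A T} {Θ : Set (Param d)} (hconv : Convex ℝ Θ)
    {pol : Param d → S → A → ℝ} (hpol : IsPolicyClass M Θ pol)
    {L₁ L₂ : ℝ} (hreg : LogPolicyRegular Θ pol L₁ L₂) {e : EstimatorKind} {G G₂ : ℝ}
    (hG : EstimatorBounds M Θ pol e G G₂) {N w k : ℕ}
    {α lam : ℕ → ℕ → ℝ} {θ : ℕ → Param d} {τ : ℕ → Fin N → Traj S A T}
    (hα : ∀ i ∈ Finset.Icc (winStart w k) k, α i k = 1 / (win w k : ℝ))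
    {l : ℝ} (hl0 : 0 < l) (hl : l ≤ 1) (hlam : ∀ i ∈ Finset.Icc (winStart w k) k, lam i k = l)
    (hθ : ∀ i ∈ Finset.Icc (winStart w k) k, θ i ∈ Θ) {y y' : Param d} (hy : y ∈ Θ)
    (hy' : y' ∈ Θ) :
    ‖mpm M pol e w α lam θ τ k y' - mpm M pol e w α lam θ τ k y‖ ≤
      (G * T * L₁ + G₂) / l * ‖y' - y‖ := by
  have hG0 := hG.G_pos
  have hG2 := hG.G₂_pos
  have hL := hreg.L₁_pos
  rw [mpm_eq hα, mpm_eq hα, ← Finset.sum_sub_distrib]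
  simp only [← smul_sub, ← Finset.sum_sub_distrib]
  refine norm_window_average_le (by positivity) fun i hi j => ?_
  rw [hlam i hi]
  exact norm_powerWeight_smul_sub_le hconv hpol hreg hG hl0 hl (hθ i hi) hy hy' _

/-- Translates between the exponent of the supermartingale and the error of the estimate; equal `α`
and equal `lam` across the window are what makes this an identity. -/
theorem sum_weightedEstim_eq {M : MDP S A T} {pol : Param d → S → A → ℝ}
    {e : EstimatorKind} {N w k : ℕ} (hN : 0 < N) (hw : 0 < win w k)
    {α lam : ℕ → ℕ → ℝ} {θ : ℕ → Param d} {τ : ℕ → Fin N → Traj S A T}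
    (hα : ∀ i ∈ Finset.Icc (winStart w k) k, α i k = 1 / (win w k : ℝ))
    {l : ℝ} (hlam : ∀ i ∈ Finset.Icc (winStart w k) k, lam i k = l) (u y m : Param d) (c b : ℝ) :
    ∑ i ∈ Finset.Icc (winStart w k) k, ∑ j : Fin N, (c *
        (weightedEstim M pol e l u y (θ i) (τ i j) - inner ℝ u m) - b) =
      N * win w k * (c * inner ℝ u (mpm M pol e w α lam θ τ k y - m) - b) := by
  have h1 : inner ℝ u (mpm M pol e w α lam θ τ k y) = 1 / (N : ℝ) * (1 / (win w k : ℝ) *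
      ∑ i ∈ Finset.Icc (winStart w k) k, ∑ j : Fin N,
        weightedEstim M pol e l u y (θ i) (τ i j)) := by
    rw [mpm_eq hα, inner_sum, Finset.mul_sum, Finset.mul_sum]
    refine Finset.sum_congr rfl fun i hi => ?_
    rw [hlam i hi, real_inner_smul_right, inner_sum]
    simp only [real_inner_smul_right, weightedEstim, ← Finset.mul_sum]
  have hN' : (N : ℝ) ≠ 0 := by positivity
  have hw' : (win w k : ℝ) ≠ 0 := by positivity
  rw [inner_sub_right, h1]
  simp only [Finset.sum_sub_distrib, ← Finset.mul_sum, Finset.sum_const, card_window,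
    Finset.card_univ, Fintype.card_fin, nsmul_eq_mul]
  field_simp

/-- The iterates of the window stay close to its first parameter. -/
theorem norm_param_sub_le {θ : ℕ → Param d} {k₀ k : ℕ} {r : ℝ}
    (h : ∀ i ∈ Finset.Ico k₀ k, ‖θ (i + 1) - θ i‖ ≤ r) (hk : k₀ ≤ k) :
    ‖θ k - θ k₀‖ ≤ (k - k₀ : ℕ) * r := by
  induction k, hk using Nat.le_induction with
  | base => simp
  | succ k hk ih =>
    have h1 := ih fun i hi => h i (Finset.mem_Ico.2
      ⟨(Finset.mem_Ico.1 hi).1, (Finset.mem_Ico.1 hi).2.trans (Nat.lt_succ_self k)⟩)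
    have h2 := h k (Finset.mem_Ico.2 ⟨hk, Nat.lt_succ_self k⟩)
    calc _ ≤ ‖θ (k + 1) - θ k‖ + ‖θ k - θ k₀‖ := norm_sub_le_norm_sub_add_norm_sub _ _ _
      _ ≤ r + (k - k₀ : ℕ) * r := add_le_add h2 h1
      _ = _ := by rw [Nat.succ_sub hk]; push_cast; ring

theorem le_maxStep {ζ : ℕ → ℝ} {w k i : ℕ} (hi : i ∈ Finset.Ico (winStart w k) k) :
    ζ i ≤ maxStep ζ w k :=
  le_csSup ((Set.finite_Ico _ _).image ζ).bddAbove ⟨i, by simpa using hi, rfl⟩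

theorem maxStep_nonneg {ζ : ℕ → ℝ} (hζ : ∀ i, 0 < ζ i) (w k : ℕ) : 0 ≤ maxStep ζ w k :=
  Real.sSup_nonneg (by rintro _ ⟨i, -, rfl⟩; exact (hζ i).le)

/-- The numerical inequality comparing the radius of the window with the mesh of the net. -/
theorem net_radius_numeric {d D n C : ℝ} (hd : 1 ≤ d) (hD : 0 < D) (hn : 0 < n)
    (hC : d * Real.log 6 ≤ C) :
    80 * √d ≤ 7.8 * (3 * √3) *
      (n * (√(4 * (d * Real.log 6) / (3 * D * n)) * √(D * C / n))) := by
  have hlog := log_six_ge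
  have hC' : (1.73 : ℝ) ≤ C := by nlinarith
  have hd' : d * 1.73 ≤ d * Real.log 6 := by gcongr
  set x := n * (√(4 * (d * Real.log 6) / (3 * D * n)) * √(D * C / n)) with hx
  -- The sample size and `D` cancel, so the comparison reduces to one between pure numbers and `d`.
  have hx2 : x ^ 2 = 4 / 3 * (d * Real.log 6) * C := by
    rw [hx, mul_pow, mul_pow, Real.sq_sqrt (by positivity), Real.sq_sqrt (by positivity)]
    field_simp
  have hx3 : 4 / 3 * (d * 1.73) * 1.73 ≤ x ^ 2 := by rw [hx2]; gcongr
  have hs3 : √3 ^ 2 = (3 : ℝ) := Real.sq_sqrt (by norm_num)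
  have hsd : √d ^ 2 = d := Real.sq_sqrt (by linarith)
  refine le_of_sq_le_sq ?_ (by positivity)
  calc (80 * √d) ^ 2 = 6400 * d := by rw [mul_pow, hsd]; norm_num
    -- The coefficient of `d` on the right is about `6555`, against `6400` on the left.
    _ ≤ 7.8 ^ 2 * (9 * 3) * (4 / 3 * (d * 1.73) * 1.73) := by nlinarith
    _ ≤ 7.8 ^ 2 * (9 * 3) * x ^ 2 := by gcongr
    _ = _ := by linear_combination (-(7.8 ^ 2 * 9 * x ^ 2) : ℝ) * hs3

/-! ### The deviation bound at the current iterate -/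

/-- The argument of the logarithm in `logFactor`, without the additive constant `6`. -/
def coverTerm (d T N w k : ℕ) (D G G₂ L₁ : ℝ) (ζ : ℕ → ℝ) : ℝ :=
  (G * T * L₁ + G₂) * (1 + √(3 / 4 * D * N * win w k)) *
    (3 * √3 * maxStep ζ w k * (win w k : ℝ) ^ 2 * N / (4 * √d))

theorem coverTerm_nonneg {N w k : ℕ} {D G G₂ L₁ : ℝ} {ζ : ℕ → ℝ} (hG : 0 < G) (hG₂ : 0 < G₂)
    (hL : 0 < L₁) (hζ : ∀ i, 0 < ζ i) : 0 ≤ coverTerm d T N w k D G G₂ L₁ ζ := by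
  have := maxStep_nonneg hζ w k
  unfold coverTerm
  positivity

theorem log_six_le_complexity {N w k : ℕ} {D G G₂ L₁ : ℝ} {ζ : ℕ → ℝ} (hG : 0 < G) (hG₂ : 0 < G₂)
    (hL : 0 < L₁) (hζ : ∀ i, 0 < ζ i) {δ : ℝ} (hδ : 0 < δ) (hδ1 : δ < 1) :
    d * Real.log 6 ≤ complexity d T N w k D G G₂ L₁ ζ δ ∧
      0 < complexity d T N w k D G G₂ L₁ ζ δ := by
  have hK := coverTerm_nonneg (d := d) (T := T) (N := N) (w := w) (k := k) (D := D) hG hG₂ hL hζ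
  have h1 : Real.log 6 ≤ logFactor d T N w k D G G₂ L₁ ζ :=
    Real.log_le_log (by norm_num) (le_add_of_nonneg_right hK)
  have h2 : 0 < Real.log (1 / δ) := Real.log_pos (by rw [lt_div_iff₀ hδ]; linarith)
  have h3 : (d : ℝ) * Real.log 6 ≤ d * logFactor d T N w k D G G₂ L₁ ζ := by gcongr
  have h4 : 0 ≤ (d : ℝ) * Real.log 6 := mul_nonneg (by positivity) (by linarith [log_six_ge])
  unfold complexity
  exact ⟨by linarith, by linarith⟩

/-- The definition of `complexity` is exactly what makes a union of `(6 + coverTerm)^d` events of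
probability `exp (-C)` cost `δ`. -/
theorem exp_neg_complexity {N w k : ℕ} {D G G₂ L₁ : ℝ} {ζ : ℕ → ℝ} (hG : 0 < G) (hG₂ : 0 < G₂)
    (hL : 0 < L₁) (hζ : ∀ i, 0 < ζ i) {δ : ℝ} (hδ : 0 < δ) :
    (6 + coverTerm d T N w k D G G₂ L₁ ζ) ^ d *
      Real.exp (-complexity d T N w k D G G₂ L₁ ζ δ) = δ := by
  have hK := coverTerm_nonneg (d := d) (T := T) (N := N) (w := w) (k := k) (D := D) hG hG₂ hL hζ
  have h6 : 0 < 6 + coverTerm d T N w k D G G₂ L₁ ζ := by linarith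
  have hpow : (6 + coverTerm d T N w k D G G₂ L₁ ζ) ^ d =
      Real.exp (d * logFactor d T N w k D G G₂ L₁ ζ) := by
    rw [Real.exp_nat_mul]
    exact congrArg (· ^ d) (Real.exp_log h6).symm
  rw [hpow, ← Real.exp_add, complexity, one_div, Real.log_inv]
  rw [show (d : ℝ) * logFactor d T N w k D G G₂ L₁ ζ +
    -(d * logFactor d T N w k D G G₂ L₁ ζ + -Real.log δ) = Real.log δ by ring, Real.exp_log hδ]

/-- Bound for the distance of the current parameter from the first one of the window. -/
def windowRadius (d N w k : ℕ) (D G : ℝ) (ζ : ℕ → ℝ) : ℝ :=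
  win w k * (maxStep ζ w k * (G / √(4 * (d * Real.log 6) / (3 * D * (N * win w k)))))

theorem norm_param_sub_le_windowRadius {M : MDP S A T} {Θ : Set (Param d)}
    {pol : Param d → S → A → ℝ} (hpol : IsPolicyClass M Θ pol) {D : ℝ} (hD : 1 ≤ D)
    {e : EstimatorKind} {G G₂ : ℝ} (hG : EstimatorBounds M Θ pol e G G₂) {N w k : ℕ}
    (hd : 0 < d) (hN : 0 < N) (hw : 1 ≤ w) (hk : 1 ≤ k) {ζ : ℕ → ℝ} (hζ : ∀ i, 0 < ζ i)
    {α lam : ℕ → ℕ → ℝ}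
    (hα : ∀ z ∈ Finset.Icc 1 k, ∀ i ∈ Finset.Icc (winStart w z) z, α i z = 1 / (win w z : ℝ))
    (hlam : ∀ z ∈ Finset.Ico 1 k, ∃ δ' : ℝ, 0 < δ' ∧ δ' < 1 ∧
      ∀ i ∈ Finset.Icc (winStart w z) z, lamIndep d N w z D δ' ≤ lam i z ∧ lam i z ≤ 1)
    {θ : ℕ → Param d} {τ : ℕ → Fin N → Traj S A T} (hθ : ∀ i ∈ Finset.Icc 1 k, θ i ∈ Θ)
    (hupd : ∀ i ∈ Finset.Ico 1 k, θ (i + 1) = θ i + ζ i • mpm M pol e w α lam θ τ i (θ i)) :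
    ‖θ k - θ (winStart w k)‖ ≤ windowRadius d N w k D G ζ := by
  have hlog : 0 < Real.log 6 := by linarith [log_six_ge]
  have hwk : 0 < win w k := lt_min hw hk
  set l := √(4 * (d * Real.log 6) / (3 * D * (N * win w k))) with hl
  have hl0 : 0 < l := Real.sqrt_pos.2 (by positivity)
  have hms := maxStep_nonneg hζ w k
  have hG0 := hG.G_pos
  have hstart := winStart_le hw hk
  have hone : 1 ≤ winStart w k := by unfold winStart; omega
  have hstep : ∀ i ∈ Finset.Ico (winStart w k) k,
      ‖θ (i + 1) - θ i‖ ≤ maxStep ζ w k * (G / l) := by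
    intro i hi
    have hi' := Finset.mem_Ico.1 hi
    have hi1 : i ∈ Finset.Ico 1 k := Finset.mem_Ico.2 ⟨by omega, hi'.2⟩
    have hi2 : i ∈ Finset.Icc 1 k := Finset.mem_Icc.2 ⟨by omega, by omega⟩
    obtain ⟨δ', hδ0, hδ1, hb⟩ := hlam i hi1
    have hwi : 0 < win w i := lt_min hw (by omega)
    have hwin : (win w i : ℝ) ≤ win w k := by
      exact_mod_cast min_le_min_left w hi'.2.le
    -- One lower bound for all iterations of the window: drop `log (1/δ') ≥ 0` and enlarge the
    -- window size from `ω_i` to `ω_k`.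
    have hle : l ≤ lamIndep d N w i D δ' := by
      refine Real.sqrt_le_sqrt ?_
      have hnn : 0 ≤ Real.log (1 / δ') := Real.log_nonneg (by rw [le_div_iff₀ hδ0]; linarith)
      rw [← mul_assoc (3 * D)]
      gcongr
      linarith
    have hm : ‖mpm M pol e w α lam θ τ i (θ i)‖ ≤ G / l :=
      norm_mpm_le hpol hG (hα i hi2) hl0 (fun z hz => ⟨hle.trans (hb z hz).1, (hb z hz).2⟩)
        (fun z hz => hθ z (by
          have := Finset.mem_Icc.1 hz
          have h1 : 1 ≤ winStart w i := by unfold winStart; omega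
          exact Finset.mem_Icc.2 ⟨by omega, by omega⟩)) (hθ i hi2)
    rw [hupd i hi1, add_sub_cancel_left, norm_smul, Real.norm_of_nonneg (hζ i).le]
    exact mul_le_mul (le_maxStep hi) hm (norm_nonneg _) hms
  refine (norm_param_sub_le hstep hstart).trans ?_
  have hcard : ((k - winStart w k : ℕ) : ℝ) ≤ win w k := by
    have h2 : win w k ≤ k := min_le_right _ _
    exact_mod_cast (by unfold winStart; omega : k - winStart w k ≤ win w k)
  exact mul_le_mul_of_nonneg_right hcard (by positivity)

/-- The product of the sizes of the two nets is at most `(6 + coverTerm)^d`. -/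
theorem net_card_numeric {N w k : ℕ} {D G G₂ L₁ C l η : ℝ} {ζ : ℕ → ℝ} (hG : 0 < G)
    (hG₂ : 0 < G₂) (hL : 0 < L₁) (hζ : ∀ i, 0 < ζ i) (hd : 0 < d) (hN : 0 < N)
    (hw : 0 < win w k) (hD : 1 ≤ D) (hC : d * Real.log 6 ≤ C)
    (hl : l = √(4 * C / (3 * D * N * win w k)))
    (hη : η = 7.8 * G * √(D * C / (N * win w k)) / (2 * ((G * T * L₁ + G₂) * (1 + 1 / l)))) :
    5 * (1 + 2 * windowRadius d N w k D G ζ / η) ≤ 6 + coverTerm d T N w k D G G₂ L₁ ζ := by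
  have hd1 : (1 : ℝ) ≤ d := by exact_mod_cast hd
  have hlog := log_six_ge
  have hC1 : 1 ≤ C := by nlinarith
  have hn : 0 < (N : ℝ) * win w k := by positivity
  have hms := maxStep_nonneg hζ w k
  set Q := G * T * L₁ + G₂ with hQ
  have hQ0 : 0 < Q := by positivity
  set l₀ := √(4 * (d * Real.log 6) / (3 * D * (N * win w k))) with hl₀
  set u := √(D * C / (N * win w k)) with hu
  have hlog0 : 0 < Real.log 6 := by linarith
  have hl₀0 : 0 < l₀ := Real.sqrt_pos.2 (by positivity)
  have hu0 : 0 < u := Real.sqrt_pos.2 (by positivity)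
  have hl0 : 0 < l := by rw [hl]; exact Real.sqrt_pos.2 (by positivity)
  -- Here `C ≥ 1` is used; it replaces `1/l` by a quantity that does not involve `C`, as `coverTerm`
  -- requires.
  have hinv : 1 / l ≤ √(3 / 4 * D * N * win w k) := by
    rw [hl, one_div, ← Real.sqrt_inv]
    refine Real.sqrt_le_sqrt ?_
    rw [inv_div, div_le_iff₀ (by positivity)]
    have : 0 ≤ 3 * D * N * win w k := by positivity
    nlinarith
  have hnum := net_radius_numeric hd1 (by linarith : 0 < D) hn hC
  rw [← hl₀, ← hu] at hnum
  have hsd : 0 < √(d : ℝ) := Real.sqrt_pos.2 (by positivity)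
  have hkey : 20 * (win w k * (maxStep ζ w k / l₀)) / (7.8 * u) ≤
      3 * √3 * maxStep ζ w k * (win w k : ℝ) ^ 2 * N / (4 * √d) := by
    have heq : 20 * (win w k * (maxStep ζ w k / l₀)) / (7.8 * u) =
        maxStep ζ w k * win w k * (80 * √d) / (7.8 * (l₀ * u) * (4 * √d)) := by
      field_simp
      ring
    rw [heq, ← div_div]
    gcongr
    rw [div_le_iff₀ (by positivity)]
    calc _ ≤ maxStep ζ w k * win w k *
          (7.8 * (3 * √3) * (N * win w k * (l₀ * u))) := by gcongr
      _ = _ := by ring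
  have hR : 10 * windowRadius d N w k D G ζ / η =
      Q * (1 + 1 / l) * (20 * (win w k * (maxStep ζ w k / l₀)) / (7.8 * u)) := by
    rw [hη, windowRadius, ← hl₀]
    field_simp
    ring
  have hmain : 10 * windowRadius d N w k D G ζ / η ≤ coverTerm d T N w k D G G₂ L₁ ζ := by
    rw [hR, coverTerm, ← hQ]
    gcongr
  -- The directions contribute a factor `5` per dimension; the remaining constant `5` fits under the
  -- `6` in the logarithm.
  have : 5 * (1 + 2 * windowRadius d N w k D G ζ / η) =
      5 + 10 * windowRadius d N w k D G ζ / η := by ring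
  linarith

/-- If the exponential deviations are controlled in all directions of a half-net, the estimate is
close to its target. -/
theorem norm_mpm_sub_meanEstim_le {M : MDP S A T} {pol : Param d → S → A → ℝ}
    {e : EstimatorKind} {N w k : ℕ} (hN : 0 < N) (hw : 0 < win w k) {D G C l : ℝ} (hD : 1 ≤ D)
    (hG : 0 < G) (hC : 0 < C) (hl : l = √(4 * C / (3 * D * N * win w k)))
    {α lam : ℕ → ℕ → ℝ} {θ : ℕ → Param d} {τ : ℕ → Fin N → Traj S A T}
    (hα : ∀ i ∈ Finset.Icc (winStart w k) k, α i k = 1 / (win w k : ℝ))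
    (hlam : ∀ i ∈ Finset.Icc (winStart w k) k, lam i k = l) {U : Finset (Param d)}
    (hU : ∀ x : Param d, ‖x‖ ≤ 1 → ∃ v ∈ U, dist x v < 1 / 2) {y : Param d}
    (h : ∀ u ∈ U, ∑ i ∈ Finset.Icc (winStart w k) k, ∑ j : Fin N, (l / G *
        (weightedEstim M pol e l u y (θ i) (τ i j) - inner ℝ u (meanEstim M pol e y)) -
          11 / 4 * l ^ 2 * D) < C) :
    ‖mpm M pol e w α lam θ τ k y - meanEstim M pol e y‖ ≤
      8.1 * G * √(D * C / (N * win w k)) := by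
  have hn : 0 < (N : ℝ) * win w k := by positivity
  have hl0 : 0 < l := by rw [hl]; exact Real.sqrt_pos.2 (by positivity)
  have hl2 : l ^ 2 = 4 * C / (3 * D * N * win w k) := by
    rw [hl, Real.sq_sqrt (by positivity)]
  set u₀ := √(D * C / (N * win w k)) with hu₀
  have hu0 : 0 < u₀ := Real.sqrt_pos.2 (by positivity)
  -- The prescribed `l` satisfies `N ω_k · 3/4 l² D = C`, hence `11/4` becomes `11/3 C`.
  have hb : N * win w k * (11 / 4 * l ^ 2 * D) = 11 / 3 * C := by
    rw [hl2]
    field_simp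
  have hlu : C / (N * win w k * l) = √(3 / 4) * u₀ := by
    have h1 : (C / (N * win w k * l)) ^ 2 = (√(3 / 4) * u₀) ^ 2 := by
      rw [div_pow, mul_pow, mul_pow _ u₀, hl2, hu₀, Real.sq_sqrt (by norm_num),
        Real.sq_sqrt (by positivity)]
      field_simp
    exact (sq_eq_sq₀ (by positivity) (by positivity)).1 h1
  have hsq : √(3 / 4 : ℝ) ≤ 0.867 := by
    rw [Real.sqrt_le_left (by norm_num)]
    norm_num
  -- `14/3` is the threshold `1` plus the compensator `11/3`. Doubling for the half-net and using
  -- `√(3/4) ≤ 0.867` gives a factor below `8.1`.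
  refine (norm_le_two_mul_of_inner_le hU (B := 14 / 3 * G * (C / (N * win w k * l)))
    fun u hu => ?_).trans ?_
  · have h1 := h u hu
    rw [sum_weightedEstim_eq hN hw hα hlam, mul_sub, hb] at h1
    set z := inner ℝ u (mpm M pol e w α lam θ τ k y - meanEstim M pol e y)
    have h2 : N * win w k * (l / G * z) ≤ 14 / 3 * C := by linarith
    have h3 : N * win w k * (l / G * z) = z * ((N * win w k * l) / G) := by ring
    rw [h3, ← le_div_iff₀ (by positivity)] at h2
    refine h2.trans (le_of_eq ?_)
    field_simp
  · rw [hlu]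
    have : 0 ≤ G * u₀ := by positivity
    nlinarith

/-- Outside finitely many bad events, indexed by a direction and a displacement, the net target
nearest to the current iterate is well estimated; Lipschitz continuity transfers this to the
iterate. -/
theorem IsHistory.measure_error_le {M : MDP S A T} {Θ : Set (Param d)} (hΘ : IsOpen Θ)
    (hconv : Convex ℝ Θ) {pol : Param d → S → A → ℝ} (hpol : IsPolicyClass M Θ pol)
    {L₁ L₂ : ℝ} (hreg : LogPolicyRegular Θ pol L₁ L₂) {D : ℝ} (hD : BoundedChiSq M Θ pol D)
    {e : EstimatorKind} {G G₂ : ℝ} (hG : EstimatorBounds M Θ pol e G G₂) {N w k : ℕ}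
    (hd : 0 < d) (hw : 1 ≤ w) (hk : 1 ≤ k) {δ : ℝ} (hδ : 0 < δ) (hδ1 : δ < 1)
    {ζ : ℕ → ℝ} (hζ : ∀ i, 0 < ζ i)
    (hbatch : 4 * complexity d T N w k D G G₂ L₁ ζ δ / (3 * D) ≤ N)
    {α lam : ℕ → ℕ → ℝ}
    (hα : ∀ z ∈ Finset.Icc 1 k, ∀ i ∈ Finset.Icc (winStart w z) z, α i z = 1 / (win w z : ℝ))
    (hlamk : ∀ i ∈ Finset.Icc (winStart w k) k, lam i k = lamDep d T N w k D G G₂ L₁ ζ δ)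
    (hlam : ∀ z ∈ Finset.Ico 1 k, ∃ δ' : ℝ, 0 < δ' ∧ δ' < 1 ∧
      ∀ i ∈ Finset.Icc (winStart w z) z, lamIndep d N w z D δ' ≤ lam i z ∧ lam i z ≤ 1)
    {Ω : Type*} [MeasurableSpace Ω] {P : Measure Ω} [IsProbabilityMeasure P]
    {θ : ℕ → Ω → Param d} {τ : ℕ → Fin N → Ω → Traj S A T}
    (hist : IsHistory M Θ pol e w α lam ζ k P θ τ) :
    P {x | 16 * G * √(D * complexity d T N w k D G G₂ L₁ ζ δ / (N * win w k)) <
        ‖mpm M pol e w α lam (fun i => θ i x) (fun i j => τ i j x) k (θ k x) -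
          gradient (J M pol) (θ k x)‖} ≤ ENNReal.ofReal δ := by
  have hG0 := hG.G_pos
  have hG20 := hG.G₂_pos
  have hL := hreg.L₁_pos
  have hD1 := hD.one_le
  obtain ⟨hC, hC0⟩ := log_six_le_complexity (d := d) (T := T) (N := N) (w := w) (k := k) (D := D)
    hG0 hG20 hL hζ hδ hδ1
  have hexp := exp_neg_complexity (d := d) (T := T) (N := N) (w := w) (k := k) (D := D)
    hG0 hG20 hL hζ hδ
  set C := complexity d T N w k D G G₂ L₁ ζ δ with hCdef
  have hwk : 0 < win w k := lt_min hw hk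
  have hN : 0 < N := by
    have : 0 < 4 * C / (3 * D) := by positivity
    exact_mod_cast this.trans_le hbatch
  set l := lamDep d T N w k D G G₂ L₁ ζ δ with hldef
  have hl : l = √(4 * C / (3 * D * N * win w k)) := rfl
  have hl0 : 0 < l := by rw [hl]; exact Real.sqrt_pos.2 (by positivity)
  have hl1 : l ≤ 1 := by
    rw [hl, Real.sqrt_le_one, div_le_one (by positivity)]
    rw [div_le_iff₀ (by positivity)] at hbatch
    have hw1 : (1 : ℝ) ≤ win w k := by exact_mod_cast hwk
    have : 0 ≤ 3 * D * N := by positivity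
    nlinarith
  set u₀ := √(D * C / (N * win w k)) with hu₀
  have hu0 : 0 < u₀ := Real.sqrt_pos.2 (by positivity)
  set Q := G * T * L₁ + G₂ with hQ
  have hQ0 : 0 < Q := by positivity
  -- The mesh is chosen so that a change of target by `2η` alters the estimate and its mean by `7.8
  -- G u₀` in total (`hmesh`).
  set η := 7.8 * G * u₀ / (2 * (Q * (1 + 1 / l))) with hη
  have hη0 : 0 < η := by positivity
  set R := windowRadius d N w k D G ζ with hR
  have hR0 : 0 ≤ R := by
    have := maxStep_nonneg hζ w k
    rw [hR, windowRadius]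
    positivity
  set k₀ := winStart w k with hk₀
  have hk₀k : k₀ ≤ k := winStart_le hw hk
  have hk₀1 : 1 ≤ k₀ := by rw [hk₀, winStart]; omega
  obtain ⟨U, hU1, hU, hUcard⟩ := exists_net (E := Param d) zero_le_one
    (by norm_num : (0 : ℝ) < 1 / 2)
  obtain ⟨V, -, hV, hVcard⟩ := exists_net (E := Param d) hR0 hη0
  have hΘ_ae : ∀ᵐ x ∂P, ∀ i ∈ Finset.Icc 1 k, θ i x ∈ Θ :=
    (ae_ball_iff (Finset.countable_toSet _)).2 hist.param_mem
  have hupd_ae : ∀ᵐ x ∂P, ∀ i ∈ Finset.Ico 1 k, θ (i + 1) x = θ i x +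
      ζ i • mpm M pol e w α lam (fun z => θ z x) (fun z j => τ z j x) i (θ i x) :=
    (ae_ball_iff (Finset.countable_toSet _)).2 hist.update
  obtain ⟨x₀, hx₀⟩ := hΘ_ae.exists
  have hθ₀ : θ k x₀ ∈ Θ := hx₀ k (Finset.mem_Icc.2 ⟨hk, le_rfl⟩)
  -- The translate `θ k₀ + v` may leave `Θ`, so a nearby point of `Θ` is selected; being a function
  -- of `θ k₀` alone, it is an admissible target.
  choose φ hφm hφΘ hφd using fun v : Param d => exists_measurable_selection hΘ hθ₀ v η
  let bad : Param d → Param d → Set Ω := fun u v =>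
    {x | C ≤ ∑ i ∈ Finset.Icc k₀ k, ∑ j : Fin N, (l / G *
        (weightedEstim M pol e l u (φ v (θ k₀ x)) (θ i x) (τ i j x) -
          inner ℝ u (meanEstim M pol e (φ v (θ k₀ x)))) - 11 / 4 * l ^ 2 * D)}
  have hsub : {x | 16 * G * u₀ <
      ‖mpm M pol e w α lam (fun i => θ i x) (fun i j => τ i j x) k (θ k x) -
        gradient (J M pol) (θ k x)‖} ≤ᵐ[P] (⋃ u ∈ U, ⋃ v ∈ V, bad u v : Set Ω) := by
    filter_upwards [hΘ_ae, hupd_ae] with x hxΘ hxupd hx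
    by_contra hgood
    have hgood' : ∀ u ∈ U, ∀ v ∈ V, x ∉ bad u v := by
      intro u hu v hv hxb
      exact hgood (Set.mem_biUnion hu (Set.mem_biUnion hv hxb))
    have hxk : θ k x ∈ Θ := hxΘ k (Finset.mem_Icc.2 ⟨hk, le_rfl⟩)
    have hxwin : ∀ i ∈ Finset.Icc k₀ k, θ i x ∈ Θ := fun i hi =>
      hxΘ i (Finset.mem_Icc.2 ⟨hk₀1.trans (Finset.mem_Icc.1 hi).1, (Finset.mem_Icc.1 hi).2⟩)
    have hrad : ‖θ k x - θ k₀ x‖ ≤ R :=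
      norm_param_sub_le_windowRadius hpol hD1 hG hd hN hw hk hζ hα hlam (θ := fun i => θ i x)
        (τ := fun i j => τ i j x) hxΘ hxupd
    obtain ⟨v, hvV, hvd⟩ := hV _ hrad
    have hd1 : dist (θ k x) (θ k₀ x + v) < η := by
      rw [dist_eq_norm] at hvd ⊢
      rwa [← sub_sub]
    have hd2 := hφd v (θ k₀ x) (θ k x) hxk hd1
    set y := φ v (θ k₀ x) with hy
    have hyΘ : y ∈ Θ := hφΘ v _
    -- Both points lie within `η` of `θ k₀ x + v`.
    have hdist : ‖θ k x - y‖ ≤ 2 * η := by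
      rw [← dist_eq_norm]
      linarith [dist_triangle_right (θ k x) y (θ k₀ x + v)]
    have hαk := hα k (Finset.mem_Icc.2 ⟨hk, le_rfl⟩)
    have hdev := norm_mpm_sub_meanEstim_le (M := M) (pol := pol) (e := e) (α := α) (lam := lam)
      (θ := fun i => θ i x) (τ := fun i j => τ i j x) (y := y) hN hwk hD1 hG0 hC0 hl hαk hlamk hU
      fun u hu => not_le.1 (hgood' u hu v hvV)
    have hlip1 := norm_mpm_sub_le hconv hpol hreg hG (τ := fun i j => τ i j x) hαk hl0 hl1 hlamk
      hxwin hyΘ hxk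
    have hlip2 := norm_meanEstim_sub_le hΘ hconv hpol hreg hG hxk hyΘ
    rw [norm_sub_rev y] at hlip2
    have hgrad : gradient (J M pol) (θ k x) = meanEstim M pol e (θ k x) :=
      (hasGradientAt_J hΘ hconv hpol hreg e hxk).gradient
    have hmesh : Q / l * (2 * η) + Q * (2 * η) = 7.8 * G * u₀ := by
      rw [hη]
      field_simp
      ring
    have hb1 : Q / l * ‖θ k x - y‖ ≤ Q / l * (2 * η) := by gcongr
    have hb2 : Q * ‖θ k x - y‖ ≤ Q * (2 * η) := by gcongr
    have hx' : 16 * G * u₀ < ‖mpm M pol e w α lam (fun i => θ i x) (fun i j => τ i j x) k (θ k x) -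
        meanEstim M pol e (θ k x)‖ := hgrad ▸ hx
    have htri1 := norm_sub_le_norm_sub_add_norm_sub
      (mpm M pol e w α lam (fun i => θ i x) (fun i j => τ i j x) k (θ k x))
      (mpm M pol e w α lam (fun i => θ i x) (fun i j => τ i j x) k y) (meanEstim M pol e (θ k x))
    have htri2 := norm_sub_le_norm_sub_add_norm_sub
      (mpm M pol e w α lam (fun i => θ i x) (fun i j => τ i j x) k y)
      (meanEstim M pol e y) (meanEstim M pol e (θ k x))
    -- The triangle inequalities give `8.1 + 7.8 = 15.9 < 16`, a contradiction.
    have hpos : 0 < G * u₀ := by positivity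
    linarith
  have hcard : ((U.card : ℝ) * V.card) * Real.exp (-C) ≤ δ := by
    rw [← hexp]
    refine mul_le_mul_of_nonneg_right ?_ (Real.exp_pos _).le
    have hfin : Module.finrank ℝ (Param d) = d := by simp
    rw [hfin] at hUcard hVcard
    have h5 : (1 + 2 * (1 : ℝ) / (1 / 2)) = 5 := by norm_num
    rw [h5] at hUcard
    calc (U.card : ℝ) * V.card ≤ 5 ^ d * (1 + 2 * R / η) ^ d := by gcongr
      _ = (5 * (1 + 2 * R / η)) ^ d := (mul_pow _ _ _).symm
      _ ≤ _ := by
        refine pow_le_pow_left₀ (by positivity) ?_ d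
        exact net_card_numeric hG0 hG20 hL hζ hd hN hwk hD1 hC hl hη
  calc _ ≤ P (⋃ u ∈ U, ⋃ v ∈ V, bad u v) := measure_mono_ae hsub
    _ ≤ ∑ u ∈ U, ∑ v ∈ V, P (bad u v) := (measure_biUnion_finset_le _ _).trans
        (Finset.sum_le_sum fun u _ => measure_biUnion_finset_le _ _)
    _ ≤ ∑ u ∈ U, ∑ v ∈ V, ENNReal.ofReal (Real.exp (-C)) :=
        Finset.sum_le_sum fun u hu => Finset.sum_le_sum fun v _ =>
          hist.measure_deviation_le hΘ hpol hreg hD hG hl0 hl1 (hU1 u hu) hk₀1 hk₀k (hφm v)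
            (hφΘ v) C
    _ = ENNReal.ofReal (((U.card : ℝ) * V.card) * Real.exp (-C)) := by
        simp only [Finset.sum_const, nsmul_eq_mul]
        rw [ENNReal.ofReal_mul (by positivity), ENNReal.ofReal_mul (by positivity),
          ENNReal.ofReal_natCast, ENNReal.ofReal_natCast, mul_assoc]
    _ ≤ ENNReal.ofReal δ := ENNReal.ofReal_le_ofReal hcard

end RPG

end

/-! ### The theorem. -/

theorem theorem5p2 {S A : Type*} [MeasurableSpace S] [MeasurableSpace A] {T d : ℕ}
    (M : RPG.MDP S A T)
    -- the parameter space and the policy class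
    (Θ : Set (RPG.Param d)) (hΘ_open : IsOpen Θ) (hΘ_convex : Convex ℝ Θ)
    (pol : RPG.Param d → S → A → ℝ) (hpol : RPG.IsPolicyClass M Θ pol)
    -- regularity of `log π_θ` and bounded `χ²`-divergence
    (L₁ L₂ : ℝ) (hreg : RPG.LogPolicyRegular Θ pol L₁ L₂)
    (D : ℝ) (hD : RPG.BoundedChiSq M Θ pol D)
    -- REINFORCE or GPOMDP
    (e : RPG.EstimatorKind) :
    (∃ G G₂ : ℝ, RPG.EstimatorBounds M Θ pol e G G₂) ∧
    ∀ G G₂ : ℝ, RPG.EstimatorBounds M Θ pol e G G₂ →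
    ∀ (N w k : ℕ), 1 ≤ w → 1 ≤ k →
    ∀ δ : ℝ, 0 < δ → δ < 1 →
    ∀ ζ : ℕ → ℝ, (∀ i, 0 < ζ i) →
    -- the batch size condition
    4 * RPG.complexity d T N w k D G G₂ L₁ ζ δ / (3 * D) ≤ N →
    -- the coefficients of iteration `k`
    ∀ α lam : ℕ → ℕ → ℝ,
    (∀ z ∈ Finset.Icc 1 k, ∀ i ∈ Finset.Icc (RPG.winStart w z) z,
      α i z = 1 / (RPG.win w z : ℝ)) →
    (∀ i ∈ Finset.Icc (RPG.winStart w k) k, lam i k = RPG.lamDep d T N w k D G G₂ L₁ ζ δ) →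
    -- the coefficients of the earlier iterations, in particular those given by the same
    -- prescription at confidence levels of their own
    (∀ z ∈ Finset.Ico 1 k, ∃ δ' : ℝ, 0 < δ' ∧ δ' < 1 ∧
      ∀ i ∈ Finset.Icc (RPG.winStart w z) z, RPG.lamIndep d N w z D δ' ≤ lam i z ∧ lam i z ≤ 1) →
    ∀ {Ω : Type*} [MeasurableSpace Ω] (P : MeasureTheory.Measure Ω)
      [MeasureTheory.IsProbabilityMeasure P]
      (θ : ℕ → Ω → RPG.Param d) (τ : ℕ → Fin N → Ω → RPG.Traj S A T),
    RPG.IsHistory M Θ pol e w α lam ζ k P θ τ →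
    P {x | 16 * G * √(D * RPG.complexity d T N w k D G G₂ L₁ ζ δ / (N * RPG.win w k)) <
        ‖RPG.mpm M pol e w α lam (fun i => θ i x) (fun i j => τ i j x) k (θ k x) -
          gradient (RPG.J M pol) (θ k x)‖} ≤ ENNReal.ofReal δ := by
  refine ⟨RPG.exists_estimatorBounds M hreg e, ?_⟩
  intro G G₂ hG N w k hw hk δ hδ hδ1 ζ hζ hbatch α lam hα hlamk hlam Ω _ P _ θ τ hist
  -- In dimension zero the net estimates are not available (they need `d ≥ 1`), but every vector is
  -- zero and the error vanishes.
  rcases Nat.eq_zero_or_pos d with rfl | hd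
  · have hG0 := hG.G_pos
    refine le_of_eq_of_le ?_ zero_le
    convert measure_empty (μ := P)
    ext x
    simp only [Set.mem_ofPred_eq, Set.mem_empty_iff_false, iff_false, not_lt]
    rw [Subsingleton.elim (RPG.mpm M pol e w α lam _ _ k _ - _) 0, norm_zero]
    positivity
  · exact hist.measure_error_le hΘ_open hΘ_convex hpol hreg hD hG hd hw hk hδ hδ1 hζ hbatch hα
      hlamk hlam
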